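/- Conventions. A quantum channel $\mathcal{E}:\mathcal{B}(\mathcal{H}_A)\to\mathcal{B}(\mathcal{H}_B)$ between matrix algebras over finite-dimensional complex Hilbert spaces is a map $\mathcal{E}(\rho)=\sum_i E_i\rho E_i^\dagger$ with finitely many Kraus operators satisfying $\sum_i E_i^\dagger E_i=I_A$. Let $\alpha(\mathcal{E})$ be the largest number of input states whose outputs can be perfectly distinguished by a measurement (POVM), and let $\alpha^q(\mathcal{E})$ be the largest dimension of a subspace $\mathcal{H}_{A'}\subseteq\mathcal{H}_A$ for which there is a recovery channel $\mathcal{R}:\mathcal{B}(\mathcal{H}_B)\to\mathcal{B}(\mathcal{H}_{A'})$ with $\mathcal{R}(\mathcal{E}(|\psi\rangle\langle\psi|))=|\psi\rangle\langle\psi|$ for all $|\psi\rangle\in\mathcal{H}_{A'}$. The zero-error classical and quantum capacities are $$C^{(0)}(\mathcal{E})=\sup_{k\ge1}\frac{\log_2\alpha(\mathcal{E}^{\otimes k})}{k},\qquad Q^{(0)}(\mathcal{E})=\sup_{k\ge1}\frac{\log_2\alpha^q(\mathcal{E}^{\otimes k})}{k}.$$ $\mathcal{I}_2$ denotes the noiseless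 qubit channel. Theorem. Let $d\ge3$. There are a positive integer $N$, orthonormal bases $\{|\psi_{k0}\rangle,|\psi_{k1}\rangle\}$ of $\mathbb{C}^2$ and unitaries $U_k$ on $\mathbb{C}^d$ ($1\le k\le N$) such that the map $\mathcal{E}$ from $\mathcal{B}(\mathbb{C}^2\otimes\mathbb{C}^d)$ to $\mathcal{B}(\mathbb{C}^N\otimes\mathbb{C}^d)$ with the $2N$ Kraus operators $$\frac1{\sqrt N}\,|k\rangle\langle\psi_{k0}^*|\otimes I_d,\qquad \frac1{\sqrt N}\,|k\rangle\langle\psi_{k1}^*|\otimes U_k\qquad(1\le k\le N),$$ where $*$ is the entrywise complex conjugate in the standard basis, is a quantum channel (with input space of dimension $2d$) that satisfies: 1. $C^{(0)}(\mathcal{E})=0$; 2. $Q^{(0)}(\mathcal{I}_2)=1$, $Q^{(0)}(\mathcal{E})=0$, and $$Q^{(0)}(\mathcal{I}_2\otimes\mathcal{E})=\log_2 d>Q^{(0)}(\mathcal{I}_2)+Q^{(0)}(\mathcal{E})=1;$$ 3. a single use of $\mathcal{I}_2\otimes\mathcal{E}$ transmits a $d$-dimensional quantum system perfectly, that is, $\alpha^q(\mathcal{I}_2\otimes\mathcal{E})\ge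 d$; 4. a single use of $\mathcal{E}$ assisted by one shared ebit $(|00\rangle+|11\rangle)/\sqrt2$ transmits a $d$-dimensional quantum system perfectly: there are an encoding channel from the sender's half of the ebit and a $d$-dimensional system to the input of $\mathcal{E}$, and a decoding channel from the receiver's half of the ebit and the output of $\mathcal{E}$ to a $d$-dimensional system, that together recover every pure state of the $d$-dimensional system exactly. -/

import Mathlib

open scoped Kronecker ComplexOrder

noncomputable section

namespace ZeroError

variable {a b c e ι : Type*} [Fintype a] [DecidableEq a] [Fintype b] [DecidableEq b]
  [Fintype c] [DecidableEq c] [Fintype e] [DecidableEq e] [Fintype ι]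

/-- Linear maps `B(ℂ^a) → B(ℂ^b)`, for finite index types `a`, `b`. -/
abbrev SuperMap (a b : Type*) := Matrix a a ℂ →ₗ[ℂ] Matrix b b ℂ

/-- The operator `|u⟩⟨v|`. -/
def ketbra {m n : Type*} (u : m → ℂ) (v : n → ℂ) : Matrix m n ℂ :=
  Matrix.vecMulVec u (star v)

/-- The completely positive map `ρ ↦ ∑ᵢ Kᵢ ρ Kᵢ†` with Kraus operators `Kᵢ`. -/
def krausMap (K : ι → Matrix b a ℂ) : SuperMap a b where
  toFun X := ∑ i, K i * X * (K i).conjTranspose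
  map_add' X Y := by simp [Matrix.mul_add, Matrix.add_mul, Finset.sum_add_distrib]
  map_smul' r X := by simp [Finset.smul_sum]

/-- A quantum channel: a map with a Kraus form satisfying the completeness condition. -/
def IsChannel (Φ : SuperMap a b) : Prop :=
  ∃ (N : ℕ) (K : Fin N → Matrix b a ℂ),
    ∑ i, (K i).conjTranspose * K i = 1 ∧ Φ = krausMap K

/-- Density operators. -/
def IsState (ρ : Matrix a a ℂ) : Prop := ρ.PosSemidef ∧ ρ.trace = 1

/-- The tensor product of two maps, computed on matrix units; it is the linear map
with `X ⊗ Y ↦ Φ X ⊗ Ψ Y` (see `tensor_kronecker`). -/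
def tensor (Φ : SuperMap a b) (Ψ : SuperMap c e) : SuperMap (a × c) (b × e) where
  toFun X := Matrix.of fun i j => ∑ p, ∑ q, X p q *
    (Φ (Matrix.single p.1 q.1 1) i.1 j.1 * Ψ (Matrix.single p.2 q.2 1) i.2 j.2)
  map_add' X Y := by
    ext i j; simp [add_mul, Finset.sum_add_distrib]
  map_smul' r X := by
    ext i j; simp [Finset.mul_sum, mul_assoc]

/-- The `k`-fold tensor power of a map, computed on matrix units; it is the linear map with
`X₁ ⊗ ⋯ ⊗ Xₖ ↦ Φ X₁ ⊗ ⋯ ⊗ Φ Xₖ` (see `tensorPow_pi`). -/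
def tensorPow (k : ℕ) (Φ : SuperMap a b) : SuperMap (Fin k → a) (Fin k → b) where
  toFun X := Matrix.of fun i j => ∑ p, ∑ q, X p q * ∏ t, Φ (Matrix.single (p t) (q t) 1) (i t) (j t)
  map_add' X Y := by
    ext i j; simp [add_mul, Finset.sum_add_distrib]
  map_smul' r X := by
    ext i j; simp [Finset.mul_sum, mul_assoc]

theorem apply_eq_sum_single (Φ : SuperMap a b) (X : Matrix a a ℂ) (i j : b) :
    Φ X i j = ∑ p, ∑ q, X p q * Φ (Matrix.single p q 1) i j := by
  have h : X = ∑ p, ∑ q, X p q • Matrix.single p q (1 : ℂ) := by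
    conv_lhs => rw [Matrix.matrix_eq_sum_single X]
    simp
  conv_lhs => rw [h]
  simp only [map_sum, map_smul, Matrix.sum_apply, Matrix.smul_apply, smul_eq_mul]

theorem tensor_kronecker (Φ : SuperMap a b) (Ψ : SuperMap c e)
    (X : Matrix a a ℂ) (Y : Matrix c c ℂ) : tensor Φ Ψ (X ⊗ₖ Y) = Φ X ⊗ₖ Ψ Y := by
  ext i j
  rw [Matrix.kronecker_apply, apply_eq_sum_single Φ X, apply_eq_sum_single Ψ Y]
  simp only [tensor, LinearMap.coe_mk, AddHom.coe_mk, Matrix.of_apply, Matrix.kronecker_apply,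
    Fintype.sum_prod_type, Finset.sum_mul_sum]
  refine Finset.sum_congr rfl fun p _ => Finset.sum_congr rfl fun p' _ => ?_
  refine Finset.sum_congr rfl fun q _ => Finset.sum_congr rfl fun q' _ => ?_
  ring

theorem tensorPow_pi (k : ℕ) (Φ : SuperMap a b) (X : Fin k → Matrix a a ℂ) :
    tensorPow k Φ (Matrix.of fun i j => ∏ t, X t (i t) (j t)) =
      Matrix.of fun i j => ∏ t, Φ (X t) (i t) (j t) := by
  ext i j
  simp only [tensorPow, LinearMap.coe_mk, AddHom.coe_mk, Matrix.of_apply,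
    ← Finset.prod_mul_distrib]
  simp_rw [apply_eq_sum_single Φ (X _), Fintype.prod_sum]

/-- `N` messages can be sent without error by one use of `Φ`: there are input states
`ρ₁, …, ρ_N` whose outputs are perfectly distinguished by a measurement (POVM). -/
def SendsMessages (Φ : SuperMap a b) (N : ℕ) : Prop :=
  ∃ ρ : Fin N → Matrix a a ℂ, (∀ i, IsState (ρ i)) ∧
    ∃ M : Fin N → Matrix b b ℂ, (∀ i, (M i).PosSemidef) ∧ ∑ i, M i = 1 ∧
      ∀ i j, (M i * Φ (ρ j)).trace = if i = j then 1 else 0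

/-- The largest number of messages that one use of `Φ` transmits without error. -/
def alpha (Φ : SuperMap a b) : ℕ := sSup {N | SendsMessages Φ N}

/-- Some `m`-dimensional subspace of the input space is transmitted perfectly by one use
of `Φ`: the subspace is the range of the isometry `V`, through which it is identified
with `ℂ^m`, and `R` is the recovery channel. -/
def SendsSubspace (Φ : SuperMap a b) (m : ℕ) : Prop :=
  ∃ V : Matrix a (Fin m) ℂ, V.conjTranspose * V = 1 ∧
    ∃ R : SuperMap b (Fin m), IsChannel R ∧
      ∀ ψ : Fin m → ℂ, R (Φ (ketbra (V.mulVec ψ) (V.mulVec ψ))) = ketbra ψ ψ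

/-- The largest dimension of a subspace that one use of `Φ` transmits perfectly. -/
def alphaQ (Φ : SuperMap a b) : ℕ := sSup {m | SendsSubspace Φ m}

theorem SendsMessages.le {Φ : SuperMap a b} {N : ℕ} (h : SendsMessages Φ N) :
    N ≤ Fintype.card b * Fintype.card b := by
  obtain ⟨ρ, -, M, -, -, hM⟩ := h
  have hli : LinearIndependent ℂ M := by
    rw [Fintype.linearIndependent_iff]
    intro g hg j
    have h1 : ((∑ i, g i • M i) * Φ (ρ j)).trace = 0 := by simp [hg]
    simpa [Finset.sum_mul, Matrix.trace_sum, hM] using h1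
  simpa [Module.finrank_matrix] using hli.fintype_card_le_finrank

theorem SendsSubspace.le {Φ : SuperMap a b} {m : ℕ} (h : SendsSubspace Φ m) :
    m ≤ Fintype.card a := by
  obtain ⟨V, hV, -⟩ := h
  have h1 := (Matrix.rank_mul_le_right V.conjTranspose V).trans (Matrix.rank_le_card_height V)
  simpa [hV] using h1

/-- The set whose maximum defines `alpha` is bounded. -/
theorem bddAbove_sendsMessages (Φ : SuperMap a b) : BddAbove {N | SendsMessages Φ N} :=
  ⟨_, fun _ h => h.le⟩

/-- The set whose maximum defines `alphaQ` is bounded. -/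
theorem bddAbove_sendsSubspace (Φ : SuperMap a b) : BddAbove {m | SendsSubspace Φ m} :=
  ⟨_, fun _ h => h.le⟩

theorem logb_div_le {n D : ℕ} (k : ℕ+) (h : n ≤ D ^ (k : ℕ)) :
    Real.logb 2 n / (k : ℕ) ≤ Real.logb 2 (D + 1) := by
  have hk : (0 : ℝ) < (k : ℕ) := by exact_mod_cast k.pos
  have hD : (0 : ℝ) ≤ Real.logb 2 (D + 1) := Real.logb_nonneg (by norm_num) (by simp)
  rw [div_le_iff₀ hk]
  rcases Nat.eq_zero_or_pos n with rfl | hn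
  · simpa using mul_nonneg hD hk.le
  · have h2 : (n : ℝ) ≤ ((D : ℝ) + 1) ^ (k : ℕ) :=
      calc (n : ℝ) ≤ (D : ℝ) ^ (k : ℕ) := by exact_mod_cast h
        _ ≤ _ := by gcongr; linarith
    calc Real.logb 2 n ≤ Real.logb 2 (((D : ℝ) + 1) ^ (k : ℕ)) :=
          Real.logb_le_logb_of_le (by norm_num) (by exact_mod_cast hn) h2
      _ = _ := by rw [Real.logb_pow]; ring

/-- The zero-error classical capacity. -/
def C0 (Φ : SuperMap a b) : ℝ :=
  ⨆ k : ℕ+, Real.logb 2 (alpha (tensorPow (k : ℕ) Φ)) / (k : ℕ)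

/-- The zero-error quantum capacity. -/
def Q0 (Φ : SuperMap a b) : ℝ :=
  ⨆ k : ℕ+, Real.logb 2 (alphaQ (tensorPow (k : ℕ) Φ)) / (k : ℕ)

/-- The supremum in `C0` is over a bounded set. -/
theorem bddAbove_C0 (Φ : SuperMap a b) : BddAbove (Set.range fun k : ℕ+ =>
    Real.logb 2 (alpha (tensorPow (k : ℕ) Φ)) / (k : ℕ)) := by
  refine ⟨Real.logb 2 ((Fintype.card b * Fintype.card b : ℕ) + 1), ?_⟩
  rintro _ ⟨k, rfl⟩
  refine logb_div_le k (csSup_le' fun N hN => ?_)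
  simpa [mul_pow] using SendsMessages.le hN

/-- The supremum in `Q0` is over a bounded set. -/
theorem bddAbove_Q0 (Φ : SuperMap a b) : BddAbove (Set.range fun k : ℕ+ =>
    Real.logb 2 (alphaQ (tensorPow (k : ℕ) Φ)) / (k : ℕ)) := by
  refine ⟨Real.logb 2 ((Fintype.card a : ℕ) + 1), ?_⟩
  rintro _ ⟨k, rfl⟩
  refine logb_div_le k (csSup_le' fun N hN => ?_)
  simpa using SendsSubspace.le hN

/-- The noiseless qubit channel. -/
def idQubit : SuperMap (Fin 2) (Fin 2) := LinearMap.id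

/-- `(|00⟩ + |11⟩)/√2 ⊗ |ψ⟩`, where the first tensor factor is the receiver's half of the
entangled pair and the other two factors are the sender's. -/
def ebitTensor {m : ℕ} (ψ : Fin m → ℂ) : Fin 2 × (Fin 2 × Fin m) → ℂ :=
  fun p => (if p.1 = p.2.1 then ((1 / Real.sqrt 2 : ℝ) : ℂ) else 0) * ψ p.2.2

/-- An arbitrary state of an `m`-dimensional system is transmitted perfectly by one use of `Φ`
assisted by one shared ebit: the sender encodes her half of the pair and the system into the
input of `Φ`, the receiver decodes from his half of the pair and the output of `Φ`. -/
def SendsWithEbit (Φ : SuperMap a b) (m : ℕ) : Prop :=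
  ∃ E : SuperMap (Fin 2 × Fin m) a, IsChannel E ∧
    ∃ R : SuperMap (Fin 2 × b) (Fin m), IsChannel R ∧
      ∀ ψ : Fin m → ℂ,
        R (tensor idQubit (Φ ∘ₗ E) (ketbra (ebitTensor ψ) (ebitTensor ψ))) = ketbra ψ ψ

/-- The Kraus operators `N^{-1/2} |k⟩⟨ψ*_{k0}| ⊗ I` and `N^{-1/2} |k⟩⟨ψ*_{k1}| ⊗ U_k`, where
`*` is the entrywise complex conjugate. -/
def retroKraus {N d : ℕ} (ψ : Fin N → Fin 2 → Fin 2 → ℂ)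
    (U : Fin N → Matrix.unitaryGroup (Fin d) ℂ) :
    Fin N × Fin 2 → Matrix (Fin N × Fin d) (Fin 2 × Fin d) ℂ :=
  fun p => ((1 / Real.sqrt N : ℝ) : ℂ) •
    (ketbra (Pi.single p.1 1) (star (ψ p.1 p.2)) ⊗ₖ
      (if p.2 = 0 then 1 else (U p.1 : Matrix (Fin d) (Fin d) ℂ)))

/-- The channel that draws `k` uniformly, measures the control qubit in the basis
`ψ*_{k0}, ψ*_{k1}`, applies `U_k` to the data if the outcome is `1`, and outputs `k` and the
data, but not the outcome. -/
def retroChannel {N d : ℕ} (ψ : Fin N → Fin 2 → Fin 2 → ℂ)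
    (U : Fin N → Matrix.unitaryGroup (Fin d) ℂ) : SuperMap (Fin 2 × Fin d) (Fin N × Fin d) :=
  krausMap (retroKraus ψ U)

end ZeroError

end

open ZeroError

/-! For a channel with Kraus operators `K i`, everything is decided by the span S of the products
`(K i)ᴴ * K j`, and the tensor powers of S play this role for tensor powers of the channel
(`tensorPow_krausMap`). Two messages pass without error only if some nonzero φ, ψ satisfy ⟨φ|X|ψ⟩ =
0 for all X in S (`exists_orthogonal_of_sendsMessages`). An isometry V carries a quantum code only
if V†XV is scalar for all X in S (`SendsSubspace.exists_isometry`).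

The label k runs over all pairs of one of three bases b of the qubit and one of finitely many
unitaries U that span all d × d matrices. The two outcomes for one k contribute |b₀⟩⟨b₁| ⊗ U, so S
contains |b₀⟩⟨b₁| ⊗ X for every X (`flip_mem_span`), hence T ⊗ X for every traceless T.

Vanishing capacities: the three bases detect any two nonzero vectors, one by b₀ and the other by b₁.
Contracting one tensor factor at a time, no pair φ, ψ is orthogonal through S^{⊗k}
(`exists_piKron_ne_zero`). Hence no two messages can be sent, and so no qubit either.

Lower bound log₂ d: let the noiseless qubit hold half of an ebit and the control hold the other
half. Measuring the control in the conjugate basis steers the reference to ψ_{ki}. The receiver,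
knowing k, measures i there and undoes the unitary (`recoveryKraus_mul`). The ebit-assisted protocol
is the same one.

Upper bound log₂ d: `card_le_of_sandwich` removes one tensor factor at a time. Either some flip in
that factor acts as a nonzero scalar on the code, and contracting with it leaves only the reference
qubit, of dimension 2 ≤ d. Or all flips vanish on the code, so the control qubit is uncorrelated
with it and can be added to it: the code dimension doubles while the environment gains a factor 2d.
Both ways a factor costs at most d. Contraction treats the two sides differently, so the induction
needs two matrices V₁, V₂ and not one isometry. -/

namespace ZeroError

open Matrix

/-! ### Tensor products of families of matrices. -/

section TensorPowers

variable {l m n : Type*} {k : ℕ}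

/-- The tensor product `Y₁ ⊗ ⋯ ⊗ Yₖ` of matrices. -/
def piKron (Y : Fin k → Matrix m n ℂ) : Matrix (Fin k → m) (Fin k → n) ℂ :=
  Matrix.of fun p q => ∏ t, Y t (p t) (q t)

theorem piKron_conjTranspose (Y : Fin k → Matrix m n ℂ) :
    (piKron Y)ᴴ = piKron fun t => (Y t)ᴴ := by
  ext p q; simp [piKron, conjTranspose_apply]

theorem piKron_mul [Fintype m] (X : Fin k → Matrix l m ℂ) (Y : Fin k → Matrix m n ℂ) :
    piKron X * piKron Y = piKron fun t => X t * Y t := by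
  ext p q
  simp only [piKron, mul_apply, of_apply, ← Finset.prod_mul_distrib, Fintype.prod_sum]

theorem piKron_one [DecidableEq m] : piKron (fun _ : Fin k => (1 : Matrix m m ℂ)) = 1 := by
  ext p q
  simp only [piKron, of_apply, one_apply, Finset.prod_ite_zero, Finset.prod_const_one]
  simp [funext_iff]

theorem piKron_update [DecidableEq (Fin k)] (Y : Fin k → Matrix m n ℂ) (t : Fin k)
    (Z : Matrix m n ℂ) (p : Fin k → m) (q : Fin k → n) :
    piKron (Function.update Y t Z) p q =
      Z (p t) (q t) * ∏ s ∈ Finset.univ.erase t, Y s (p s) (q s) := by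
  simp only [piKron, of_apply]
  rw [← Finset.mul_prod_erase _ _ (Finset.mem_univ t), Function.update_self]
  congr 1
  refine Finset.prod_congr rfl fun s hs => ?_
  rw [Function.update_of_ne (Finset.ne_of_mem_erase hs)]

/-- `piKron` as a multilinear map. -/
def piKronMultilinear (k : ℕ) (m n : Type*) :
    MultilinearMap ℂ (fun _ : Fin k => Matrix m n ℂ) (Matrix (Fin k → m) (Fin k → n) ℂ) where
  toFun := piKron
  map_update_add' Y t X X' := by
    ext p q
    simp only [Matrix.add_apply, piKron_update, add_mul]
  map_update_smul' Y t c X := by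
    ext p q
    simp only [Matrix.smul_apply, piKron_update, smul_eq_mul, mul_assoc]

/-- A multilinear map with values in a submodule on families from `s` has values in that
submodule on families from the span of `s`. -/
theorem _root_.MultilinearMap.mem_of_mem_span {R ι M P : Type*} [CommSemiring R] [Fintype ι]
    [AddCommMonoid M] [Module R M] [AddCommMonoid P] [Module R P]
    (f : MultilinearMap R (fun _ : ι => M) P) (s : Set M) (Q : Submodule R P)
    (h : ∀ Y : ι → M, (∀ t, Y t ∈ s) → f Y ∈ Q) (Y : ι → M)
    (hY : ∀ t, Y t ∈ Submodule.span R s) : f Y ∈ Q := by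
  classical
  -- Induction on the set `A` of slots known only to lie in the span; every other slot holds a
  -- generator. Span induction in a single slot enlarges `A`.
  have key : ∀ A : Finset ι, ∀ Y : ι → M, (∀ t ∈ A, Y t ∈ Submodule.span R s) →
      (∀ t ∉ A, Y t ∈ s) → f Y ∈ Q := by
    intro A
    induction A using Finset.induction_on with
    | empty => exact fun Y _ h2 => h Y fun t => h2 t (Finset.notMem_empty t)
    | insert t A ht ih =>
      intro Y h1 h2
      have h3 : ∀ Z ∈ Submodule.span R s, f (Function.update Y t Z) ∈ Q := by
        intro Z hZ
        induction hZ using Submodule.span_induction with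
        | mem Z hZ =>
          refine ih _ (fun r hr => ?_) fun r hr => ?_
          · rw [Function.update_of_ne (fun e : r = t => ht (e ▸ hr))]
            exact h1 r (Finset.mem_insert_of_mem hr)
          · by_cases e : r = t
            · subst e; simpa using hZ
            · rw [Function.update_of_ne e]
              exact h2 r (by simp [e, hr])
        | zero => simp
        | add Z Z' _ _ hz hz' => rw [f.map_update_add]; exact Q.add_mem hz hz'
        | smul c Z _ hz => rw [f.map_update_smul]; exact Q.smul_mem c hz
      simpa using h3 (Y t) (h1 t (Finset.mem_insert_self t A))
  exact key Finset.univ Y (fun t _ => hY t) (by simp)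

end TensorPowers

/-! ### Kraus forms of tensor products. -/

section Kraus

variable {a b c ι κ : Type*} [Fintype a] [DecidableEq a] [Fintype b] [DecidableEq b]
  [Fintype c] [DecidableEq c] [Fintype ι] [Fintype κ]

theorem krausMap_apply (K : ι → Matrix b a ℂ) (X : Matrix a a ℂ) :
    krausMap K X = ∑ i, K i * X * (K i)ᴴ := rfl

theorem krausMap_apply_apply (K : ι → Matrix b a ℂ) (X : Matrix a a ℂ) (i j : b) :
    krausMap K X i j = ∑ p, ∑ q, X p q * ∑ r, K r i p * star (K r j q) := by
  have h : ∀ r, (K r * X * (K r)ᴴ) i j = ∑ p, ∑ q, X p q * (K r i p * star (K r j q)) := by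
    intro r
    simp only [mul_apply, conjTranspose_apply, Finset.sum_mul]
    rw [Finset.sum_comm]
    refine Finset.sum_congr rfl fun p _ => Finset.sum_congr rfl fun q _ => ?_
    ring
  simp only [krausMap_apply, Matrix.sum_apply, h, Finset.mul_sum]
  rw [Finset.sum_comm]
  refine Finset.sum_congr rfl fun p _ => Finset.sum_comm

/-- `tensor` and `tensorPow` are defined through matrix units, so this formula is what brings them
into Kraus form. -/
theorem krausMap_single (K : ι → Matrix b a ℂ) (p q : a) (i j : b) :
    krausMap K (Matrix.single p q 1) i j = ∑ r, K r i p * star (K r j q) := by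
  rw [krausMap_apply_apply, Finset.sum_eq_single p, Finset.sum_eq_single q]
  · simp
  · intro x _ hx; simp [Matrix.single, hx.symm]
  · simp
  · intro x _ hx; simp [Matrix.single, hx.symm]
  · simp

theorem tensorPow_krausMap (k : ℕ) (K : ι → Matrix b a ℂ) :
    tensorPow k (krausMap K) = krausMap fun i : Fin k → ι => piKron fun t => K (i t) := by
  ext1 X
  ext i j
  simp only [tensorPow, LinearMap.coe_mk, AddHom.coe_mk, of_apply]
  rw [krausMap_apply_apply]
  simp only [krausMap_single, Fintype.prod_sum, piKron, of_apply, star_prod,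
    ← Finset.prod_mul_distrib]

theorem tensor_id_krausMap (K : ι → Matrix b a ℂ) :
    tensor idQubit (krausMap K) = krausMap fun i => (1 : Matrix (Fin 2) (Fin 2) ℂ) ⊗ₖ K i := by
  ext1 X
  ext i j
  simp only [tensor, LinearMap.coe_mk, AddHom.coe_mk, of_apply]
  rw [krausMap_apply_apply]
  simp only [krausMap_single]
  refine Finset.sum_congr rfl fun p _ => Finset.sum_congr rfl fun q _ => ?_
  simp only [idQubit, LinearMap.id_coe, id, Matrix.single, of_apply, kroneckerMap_apply,
    one_apply, Finset.mul_sum, star_mul']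
  refine Finset.sum_congr rfl fun r _ => ?_
  simp only [eq_comm (a := i.1), eq_comm (a := j.1)]
  by_cases h1 : p.1 = i.1 <;> by_cases h2 : q.1 = j.1 <;> simp [h1, h2]

theorem krausMap_reindex (e : κ ≃ ι) (K : ι → Matrix b a ℂ) :
    krausMap (fun i => K (e i)) = krausMap K := by
  ext1 X
  simp only [krausMap_apply]
  exact Equiv.sum_comp e fun i => K i * X * (K i)ᴴ

theorem isChannel_krausMap (K : ι → Matrix b a ℂ) (h : ∑ i, (K i)ᴴ * K i = 1) :
    IsChannel (krausMap K) := by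
  let e := (Fintype.equivFin ι).symm
  refine ⟨Fintype.card ι, fun i => K (e i), ?_, (krausMap_reindex e K).symm⟩
  rw [← h]
  exact Equiv.sum_comp e fun i => (K i)ᴴ * K i

theorem isChannel_id : IsChannel (LinearMap.id : SuperMap a a) := by
  refine ⟨1, fun _ => 1, by simp, ?_⟩
  ext1 X
  simp [krausMap_apply]

theorem mul_ketbra_mul {m n : Type*} [Fintype m] (A : Matrix n m ℂ) (u : m → ℂ) :
    A * ketbra u u * Aᴴ = ketbra (A *ᵥ u) (A *ᵥ u) := by
  rw [ketbra, mul_vecMulVec, vecMulVec_mul, ketbra, star_mulVec]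

theorem ketbra_smul {m : Type*} (z : ℂ) (u : m → ℂ) :
    ketbra (z • u) (z • u) = (z * star z) • ketbra u u := by
  ext i j; simp [ketbra, vecMulVec_apply]; ring

end Kraus

/-! ### Distinguishable outputs and orthogonality through the Kraus products. -/

section Messages

variable {a b ι : Type*} [Fintype a] [DecidableEq a] [Fintype b] [DecidableEq b] [Fintype ι]

open scoped MatrixOrder Matrix.Norms.L2Operator in
theorem _root_.Matrix.PosSemidef.exists_eq_conjTranspose_mul_self {M : Matrix b b ℂ}
    (hM : M.PosSemidef) : ∃ C : Matrix b b ℂ, M = Cᴴ * C :=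
  CStarAlgebra.nonneg_iff_eq_star_mul_self.mp hM.nonneg

/-- If the positive operator `M` has expectation zero in the output of the positive operator
`Bᴴ * B`, then it annihilates the output. -/
theorem mul_kraus_mul_eq_zero (K : ι → Matrix b a ℂ) {M : Matrix b b ℂ} (hM : M.PosSemidef)
    (B : Matrix a a ℂ) (h : (M * krausMap K (Bᴴ * B)).trace = 0) (i : ι) :
    M * (K i * Bᴴ) = 0 := by
  -- With `M = Cᴴ * C` the trace is the sum of the squared Hilbert–Schmidt norms of `C * (K i *
  -- Bᴴ)`, so each of these matrices vanishes.
  obtain ⟨C, rfl⟩ := hM.exists_eq_conjTranspose_mul_self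
  have h1 : ∀ i, (Cᴴ * C * (K i * (Bᴴ * B) * (K i)ᴴ)).trace =
      ((C * (K i * Bᴴ))ᴴ * (C * (K i * Bᴴ))).trace := fun i => by
    rw [show Cᴴ * C * (K i * (Bᴴ * B) * (K i)ᴴ) = (Cᴴ * C * (K i * Bᴴ)) * (B * (K i)ᴴ) by
      simp only [Matrix.mul_assoc], trace_mul_comm]
    simp only [conjTranspose_mul, conjTranspose_conjTranspose, Matrix.mul_assoc]
  rw [krausMap_apply, Finset.mul_sum, trace_sum, Finset.sum_congr rfl fun i _ => h1 i,
    Finset.sum_eq_zero_iff_of_nonneg fun i _ =>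
      (posSemidef_conjTranspose_mul_self (C * (K i * Bᴴ))).trace_nonneg] at h
  have h2 := trace_conjTranspose_mul_self_eq_zero_iff.mp (h i (Finset.mem_univ i))
  rw [Matrix.mul_assoc, h2, Matrix.mul_zero]

/-- Two perfectly distinguishable inputs contain pure inputs whose outputs are orthogonal. -/
theorem exists_orthogonal_of_sendsMessages (K : ι → Matrix b a ℂ) {N : ℕ} (hN : 2 ≤ N)
    (h : SendsMessages (krausMap K) N) :
    ∃ φ ψ : a → ℂ, φ ≠ 0 ∧ ψ ≠ 0 ∧ ∀ i j, star φ ⬝ᵥ ((K i)ᴴ * K j) *ᵥ ψ = 0 := by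
  obtain ⟨ρ, hρ, M, hM, hM1, hMρ⟩ := h
  have key : ∀ i, ∃ B : Matrix a a ℂ, ρ i = Bᴴ * B ∧ ∃ x, Bᴴ *ᵥ Pi.single x 1 ≠ 0 := by
    intro i
    obtain ⟨B, hB⟩ := (hρ i).1.exists_eq_conjTranspose_mul_self
    refine ⟨B, hB, ?_⟩
    by_contra! h0
    have : Bᴴ = 0 := by
      ext y x
      simpa using congrFun (h0 x) y
    have h1 := (hρ i).2
    rw [hB, this] at h1
    simp at h1
  let s : Fin N := ⟨0, by omega⟩
  let t : Fin N := ⟨1, by omega⟩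
  have hst : s ≠ t := by simp [s, t]
  obtain ⟨B, hB, x, hx⟩ := key s
  obtain ⟨D, hD, y, hy⟩ := key t
  have h1 : ∀ j, M s * (K j * Dᴴ) = 0 := by
    refine mul_kraus_mul_eq_zero K (hM s) D ?_
    rw [← hD, hMρ, if_neg hst]
  have h2 : ∀ i, (1 - M s) * (K i * Bᴴ) = 0 := by
    refine mul_kraus_mul_eq_zero K ?_ B ?_
    · rw [← hM1, ← Finset.add_sum_erase _ _ (Finset.mem_univ s), add_sub_cancel_left]
      exact posSemidef_sum _ fun i _ => hM i
    · have h3 : (krausMap K (ρ s)).trace = 1 := by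
        rw [← Matrix.one_mul (krausMap K (ρ s)), ← hM1, Finset.sum_mul, trace_sum]
        simp [hMρ]
      rw [← hB, Matrix.sub_mul, trace_sub, Matrix.one_mul, h3, hMρ, if_pos rfl, sub_self]
  refine ⟨_, _, hx, hy, fun i j => ?_⟩
  have h4 : B * (K i)ᴴ * (1 - M s) = 0 := by
    have := congrArg conjTranspose (h2 i)
    simpa [(hM s).isHermitian.eq, Matrix.mul_assoc] using this
  -- Insert `1 = (1 - M s) + M s` in the middle: the first summand is killed by the left factor, the
  -- second by the right one. The vectors φ, ψ are nonzero columns of `Bᴴ` and `Dᴴ`.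
  have h5 : B * (K i)ᴴ * (K j * Dᴴ) = 0 := by
    have h6 : B * (K i)ᴴ * (K j * Dᴴ) =
        B * (K i)ᴴ * (1 - M s) * (K j * Dᴴ) + B * (K i)ᴴ * (M s * (K j * Dᴴ)) := by
      simp only [Matrix.mul_sub, Matrix.sub_mul, Matrix.mul_assoc, Matrix.one_mul]
      abel
    rw [h6, h4, h1]
    simp
  rw [star_mulVec, conjTranspose_conjTranspose, ← dotProduct_mulVec, mulVec_mulVec, mulVec_mulVec,
    show B * ((K i)ᴴ * K j) * Dᴴ = B * (K i)ᴴ * (K j * Dᴴ) by simp only [Matrix.mul_assoc], h5]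
  simp

/-- Encode messages in an orthonormal basis of the code. Recovering and then measuring in that basis
is a POVM on the output: its elements are the basis projections pulled back by the adjoint of the
recovery. -/
theorem SendsSubspace.sendsMessages {Φ : SuperMap a b} {m : ℕ} (h : SendsSubspace Φ m) :
    SendsMessages Φ m := by
  obtain ⟨V, hV, R, ⟨n, L, hL, rfl⟩, hR⟩ := h
  let e : Fin m → Fin m → ℂ := fun i => Pi.single i 1
  refine ⟨fun i => ketbra (V *ᵥ e i) (V *ᵥ e i), fun i => ⟨?_, ?_⟩,
    fun i => ∑ r, (L r)ᴴ * ketbra (e i) (e i) * L r, fun i => ?_, ?_, fun i j => ?_⟩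
  · exact posSemidef_vecMulVec_self_star _
  · simp only [ketbra]
    rw [trace_vecMulVec, star_mulVec, dotProduct_comm, ← dotProduct_mulVec, mulVec_mulVec, hV]
    simp [e]
  · exact posSemidef_sum _ fun r _ =>
      (posSemidef_vecMulVec_self_star (e i)).conjTranspose_mul_mul_same _
  · beta_reduce
    rw [Finset.sum_comm]
    simp only [← Matrix.sum_mul, ← Matrix.mul_sum]
    have : ∑ i : Fin m, ketbra (e i) (e i) = 1 := by
      ext x y
      simp [Matrix.sum_apply, ketbra, vecMulVec_apply, e, Pi.single_apply, one_apply]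
    simpa [this] using hL
  · have h1 : ∀ X : Matrix b b ℂ, ((∑ r, (L r)ᴴ * ketbra (e i) (e i) * L r) * X).trace =
        (ketbra (e i) (e i) * krausMap L X).trace := fun X => by
      simp only [krausMap_apply, Finset.sum_mul, Finset.mul_sum, trace_sum]
      refine Finset.sum_congr rfl fun r _ => ?_
      rw [Matrix.mul_assoc, Matrix.mul_assoc, trace_mul_comm]
      simp only [Matrix.mul_assoc]
    rw [h1, hR]
    simp only [ketbra, vecMulVec_mul_vecMulVec, trace_vecMulVec]
    by_cases hij : i = j
    · subst hij; simp [e]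
    · simp [e, hij]

theorem alphaQ_le_one {Φ : SuperMap a b} (h : ∀ N, SendsMessages Φ N → N ≤ 1) :
    alphaQ Φ ≤ 1 :=
  csSup_le' fun _ hm => h _ hm.sendsMessages

theorem alpha_le_one {Φ : SuperMap a b} (h : ∀ N, SendsMessages Φ N → N ≤ 1) :
    alpha Φ ≤ 1 :=
  csSup_le' fun _ hm => h _ hm

/-- Since `Real.logb 2 0 = 0`, an upper bound on `alpha` or `alphaQ` suffices and no code of size
one need be exhibited. -/
theorem logb_natCast_eq_zero {n : ℕ} (h : n ≤ 1) : Real.logb 2 n = 0 := by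
  interval_cases n <;> simp

end Messages

/-! ### Vanishing of the classical capacity by contraction of tensor factors. -/

section Unextendible

variable {a : Type*} [Fintype a]

/-- Contraction of the first tensor factor of `φ` with `u`. -/
def contract {k : ℕ} (u : a → ℂ) (φ : (Fin (k + 1) → a) → ℂ) (p : Fin k → a) : ℂ :=
  ∑ s, star (u s) * φ (Fin.cons s p)

theorem sum_fin_succ_fun {k : ℕ} {M : Type*} [AddCommMonoid M] (f : (Fin (k + 1) → a) → M) :
    ∑ p, f p = ∑ s, ∑ p : Fin k → a, f (Fin.cons s p) := by
  rw [← (Fin.consEquiv fun _ => a).sum_comp, Fintype.sum_prod_type]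
  rfl

theorem piKron_cons {k : ℕ} {m n : Type*} (A : Matrix m n ℂ) (Y : Fin k → Matrix m n ℂ)
    (s : m) (p : Fin k → m) (s' : n) (q : Fin k → n) :
    piKron (Fin.cons A Y : Fin (k + 1) → Matrix m n ℂ) (Fin.cons s p) (Fin.cons s' q) =
      A s s' * piKron Y p q := by
  simp [piKron, Fin.prod_univ_succ]

/-- A rank one operator in the first slot splits: its ket is absorbed by φ and its bra by ψ, which
leaves a statement about one factor fewer. -/
theorem dotProduct_piKron_cons {k : ℕ} (u v : a → ℂ) (Y : Fin k → Matrix a a ℂ)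
    (φ ψ : (Fin (k + 1) → a) → ℂ) :
    star φ ⬝ᵥ piKron (Fin.cons (ketbra u v) Y : Fin (k + 1) → Matrix a a ℂ) *ᵥ ψ =
      star (contract u φ) ⬝ᵥ piKron Y *ᵥ contract v ψ := by
  simp only [dotProduct, mulVec, sum_fin_succ_fun, piKron_cons, contract, ketbra,
    vecMulVec_apply, Pi.star_apply, star_sum, Finset.mul_sum, Finset.sum_mul, star_mul', star_star]
  rw [Finset.sum_comm]
  refine Finset.sum_congr rfl fun p _ => ?_
  rw [Finset.sum_comm (s := Finset.univ) (t := Finset.univ)]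
  conv_rhs => rw [Finset.sum_comm]
  refine Finset.sum_congr rfl fun s' _ => ?_
  conv_rhs => rw [Finset.sum_comm]
  refine Finset.sum_congr rfl fun s _ => Finset.sum_congr rfl fun q _ => ?_
  ring

/-- If every two nonzero vectors are detected by the two components of some pair in `P`, then
no product of the operators `|u⟩⟨v|`, `(u, v) ∈ P`, is orthogonal to a rank one operator. -/
theorem exists_piKron_ne_zero (P : Set ((a → ℂ) × (a → ℂ)))
    (hP : ∀ w w' : a → ℂ, w ≠ 0 → w' ≠ 0 → ∃ x ∈ P, star x.1 ⬝ᵥ w ≠ 0 ∧ star x.2 ⬝ᵥ w' ≠ 0)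
    (k : ℕ) (φ ψ : (Fin k → a) → ℂ) (hφ : φ ≠ 0) (hψ : ψ ≠ 0) :
    ∃ Y : Fin k → Matrix a a ℂ, (∀ t, ∃ x ∈ P, Y t = ketbra x.1 x.2) ∧
      star φ ⬝ᵥ piKron Y *ᵥ ψ ≠ 0 := by
  induction k with
  | zero =>
    refine ⟨fun t => t.elim0, fun t => t.elim0, ?_⟩
    obtain ⟨p, hp⟩ := Function.ne_iff.mp hφ
    obtain ⟨q, hq⟩ := Function.ne_iff.mp hψ
    rw [Subsingleton.elim p default] at hp
    rw [Subsingleton.elim q default] at hq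
    simpa [dotProduct, mulVec, piKron, Fintype.sum_unique] using ⟨hp, hq⟩
  | succ k ih =>
    have key : ∀ φ : (Fin (k + 1) → a) → ℂ, φ ≠ 0 →
        ∃ p : Fin k → a, (fun s => φ (Fin.cons s p)) ≠ 0 := by
      intro φ hφ
      obtain ⟨p, hp⟩ := Function.ne_iff.mp hφ
      refine ⟨Fin.tail p, Function.ne_iff.mpr ⟨p 0, ?_⟩⟩
      simpa using hp
    -- Choose nonzero slices of φ and ψ along the first factor. A pair detecting both slices keeps
    -- both contractions nonzero, at `p` and at `q`.
    obtain ⟨p, hp⟩ := key φ hφ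
    obtain ⟨q, hq⟩ := key ψ hψ
    obtain ⟨x, hx, h1, h2⟩ := hP _ _ hp hq
    obtain ⟨Y, hY, hne⟩ := ih (contract x.1 φ) (contract x.2 ψ)
      (Function.ne_iff.mpr ⟨p, h1⟩) (Function.ne_iff.mpr ⟨q, h2⟩)
    refine ⟨Fin.cons (ketbra x.1 x.2) Y, fun t => ?_, ?_⟩
    · refine Fin.cases ?_ (fun t => ?_) t
      · exact ⟨x, hx, rfl⟩
      · simpa using hY t
    · rwa [dotProduct_piKron_cons]

variable {b ι : Type*} [DecidableEq a] [Fintype b] [DecidableEq b] [Fintype ι]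

/-- Two messages give φ, ψ orthogonal through all tensor products of Kraus products. By
multilinearity the orthogonality extends to all tensor products of operators from `P`, against
`exists_piKron_ne_zero`. -/
theorem sendsMessages_tensorPow_le_one (K : ι → Matrix b a ℂ) (P : Set ((a → ℂ) × (a → ℂ)))
    (hP : ∀ w w' : a → ℂ, w ≠ 0 → w' ≠ 0 → ∃ x ∈ P, star x.1 ⬝ᵥ w ≠ 0 ∧ star x.2 ⬝ᵥ w' ≠ 0)
    (hK : ∀ x ∈ P, ketbra x.1 x.2 ∈
      Submodule.span ℂ (Set.range fun i : ι × ι => (K i.1)ᴴ * K i.2))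
    (k N : ℕ) (h : SendsMessages (tensorPow k (krausMap K)) N) : N ≤ 1 := by
  by_contra hN
  rw [tensorPow_krausMap] at h
  obtain ⟨φ, ψ, hφ, hψ, h0⟩ := exists_orthogonal_of_sendsMessages _ (by omega) h
  obtain ⟨Y, hY, hne⟩ := exists_piKron_ne_zero P hP k φ ψ hφ hψ
  let Q : Submodule ℂ (Matrix (Fin k → a) (Fin k → a) ℂ) :=
    { carrier := {X | star φ ⬝ᵥ X *ᵥ ψ = 0}
      add_mem' := fun {X X'} hX hX' => by
        simp only [Set.mem_ofPred_eq] at *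
        rw [add_mulVec, dotProduct_add, hX, hX', add_zero]
      zero_mem' := by simp
      smul_mem' := fun c X hX => by
        simp only [Set.mem_ofPred_eq] at *
        rw [smul_mulVec, dotProduct_smul, hX, smul_zero] }
  refine hne ((piKronMultilinear k a a).mem_of_mem_span
    (Set.range fun i : ι × ι => (K i.1)ᴴ * K i.2) Q (fun Z hZ => ?_) Y fun t => ?_)
  · choose i hi using hZ
    have h1 := h0 (fun t => (i t).1) (fun t => (i t).2)
    rw [piKron_conjTranspose, piKron_mul] at h1
    have h2 : Z = fun t => (K (i t).1)ᴴ * K (i t).2 := funext fun t => (hi t).symm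
    rw [h2]
    exact h1
  · obtain ⟨x, hx, he⟩ := hY t
    rw [he]
    exact hK x hx

end Unextendible

/-! ### Necessary condition for quantum codes. -/

section KnillLaflamme

variable {a b ι : Type*} [Fintype a] [DecidableEq a] [Fintype b] [DecidableEq b] [Fintype ι]

/-- Kraus operators of the identity map are scalar. -/
theorem eq_smul_one_of_krausMap_eq {m : ℕ} (B : ι → Matrix (Fin m) (Fin m) ℂ)
    (h : ∀ ψ : Fin m → ℂ, krausMap B (ketbra ψ ψ) = ketbra ψ ψ) (i : ι) :
    ∃ z : ℂ, B i = z • (1 : Matrix (Fin m) (Fin m) ℂ) := by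
  -- Taking the expectation of `h ψ` in φ gives ∑ⱼ |⟨φ|Bⱼψ⟩|² = |⟨φ|ψ⟩|² = 0.
  have key : ∀ φ ψ : Fin m → ℂ, star φ ⬝ᵥ ψ = 0 → star φ ⬝ᵥ B i *ᵥ ψ = 0 := by
    intro φ ψ h0
    have h1 := congrArg (fun X => star φ ⬝ᵥ X *ᵥ φ) (h ψ)
    simp only [krausMap_apply, mul_ketbra_mul, sum_mulVec, dotProduct_sum] at h1
    have h2 : ∀ u : Fin m → ℂ, star φ ⬝ᵥ ketbra u u *ᵥ φ = (star φ ⬝ᵥ u) * star (star φ ⬝ᵥ u) := by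
      intro u
      rw [ketbra, vecMulVec_mulVec, dotProduct_smul, star_dotProduct]
      exact op_smul_eq_mul _ _
    simp only [h2, h0, zero_mul] at h1
    rw [Finset.sum_eq_zero_iff_of_nonneg fun j _ => mul_star_self_nonneg _] at h1
    simpa using h1 i (Finset.mem_univ i)
  have hoff : ∀ x y, x ≠ y → B i x y = 0 := by
    intro x y hxy
    simpa using key (Pi.single x 1) (Pi.single y 1) (by simp [hxy])
  have hdiag : ∀ x y, B i x x = B i y y := by
    intro x y
    by_cases hxy : x = y
    · rw [hxy]
    -- For this orthogonal pair, once off-diagonal entries vanish, the form equals the difference of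
    -- the two diagonal entries.
    have h1 := key (Pi.single x 1 - Pi.single y 1) (Pi.single x 1 + Pi.single y 1)
      (by simp [hxy, Ne.symm hxy, dotProduct_add])
    simp only [star_sub, Pi.star_single, star_one, mulVec_add, sub_dotProduct, dotProduct_add,
      mulVec_single_one, single_dotProduct, one_mul, col_apply, hoff x y hxy,
      hoff y x (Ne.symm hxy)] at h1
    linear_combination h1
  rcases Nat.eq_zero_or_pos m with rfl | hm
  · exact ⟨0, by ext x; exact x.elim0⟩
  · refine ⟨B i ⟨0, hm⟩ ⟨0, hm⟩, ?_⟩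
    ext x y
    by_cases hxy : x = y
    · subst hxy; simpa using hdiag _ _
    · simp [hxy, hoff x y hxy]

/-- The Knill–Laflamme condition. -/
theorem SendsSubspace.exists_isometry {K : ι → Matrix b a ℂ} {m : ℕ}
    (h : SendsSubspace (krausMap K) m) :
    ∃ V : Matrix a (Fin m) ℂ, Vᴴ * V = 1 ∧
      ∀ i j, ∃ z : ℂ, Vᴴ * ((K i)ᴴ * K j) * V = z • (1 : Matrix (Fin m) (Fin m) ℂ) := by
  obtain ⟨V, hV, R, ⟨n, L, hL, rfl⟩, hR⟩ := h
  have h1 := eq_smul_one_of_krausMap_eq (fun x : Fin n × ι => L x.1 * K x.2 * V) (by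
    intro ψ
    refine Eq.trans ?_ (hR ψ)
    simp only [krausMap_apply, Fintype.sum_prod_type, Matrix.mul_sum, Matrix.sum_mul]
    refine Finset.sum_congr rfl fun r _ => Finset.sum_congr rfl fun i _ => ?_
    rw [← mul_ketbra_mul V]
    simp only [conjTranspose_mul, Matrix.mul_assoc])
  choose z hz using h1
  refine ⟨V, hV, fun i j => ⟨∑ r, star (z (r, i)) * z (r, j), ?_⟩⟩
  -- Insert the completeness relation of the recovery; every `L r * K i * V` is scalar, being a
  -- Kraus operator of the identity.
  have h2 : Vᴴ * ((K i)ᴴ * K j) * V = ∑ r, (L r * K i * V)ᴴ * (L r * K j * V) := by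
    have h3 : ∀ r, (L r * K i * V)ᴴ * (L r * K j * V) =
        (Vᴴ * (K i)ᴴ) * ((L r)ᴴ * L r) * (K j * V) := fun r => by
      simp only [conjTranspose_mul, Matrix.mul_assoc]
    simp only [h3, ← Matrix.mul_sum, ← Matrix.sum_mul, hL]
    simp only [Matrix.mul_assoc, Matrix.one_mul]
  rw [h2, Finset.sum_smul]
  refine Finset.sum_congr rfl fun r _ => ?_
  rw [hz (r, i), hz (r, j)]
  simp [conjTranspose_smul, smul_smul, mul_comm]

end KnillLaflamme

/-! ### Compression of product operators between two matrices. -/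

section Sandwich

variable {a γ μ : Type*} [Fintype a] [Fintype γ] {k : ℕ}

/-- The matrix `V₁† (1 ⊗ Y₁ ⊗ ⋯ ⊗ Yₖ) V₂`, where the rows of `V₁` and `V₂` are indexed by
`γ × (Fin k → a)`. -/
def sandwich (V₁ V₂ : γ → (Fin k → a) → μ → ℂ) (Y : Fin k → Matrix a a ℂ) : Matrix μ μ ℂ :=
  Matrix.of fun i j => ∑ g, ∑ p, ∑ q, star (V₁ g p i) * piKron Y p q * V₂ g q j

theorem sandwich_cons (V₁ V₂ : γ → (Fin (k + 1) → a) → μ → ℂ) (A : Matrix a a ℂ)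
    (Y : Fin k → Matrix a a ℂ) :
    sandwich V₁ V₂ (Fin.cons A Y : Fin (k + 1) → Matrix a a ℂ) =
      ∑ s, ∑ s', A s s' • sandwich (fun g p => V₁ g (Fin.cons s p))
        (fun g p => V₂ g (Fin.cons s' p)) Y := by
  ext i j
  simp only [sandwich, of_apply, sum_fin_succ_fun, piKron_cons, Matrix.sum_apply,
    Matrix.smul_apply, smul_eq_mul, Finset.mul_sum]
  rw [Finset.sum_comm]
  refine Finset.sum_congr rfl fun s _ => ?_
  have h : ∀ g, ∑ p : Fin k → a, ∑ s', ∑ q : Fin k → a,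
      star (V₁ g (Fin.cons s p) i) * (A s s' * piKron Y p q) * V₂ g (Fin.cons s' q) j =
      ∑ s', ∑ p : Fin k → a, ∑ q : Fin k → a,
      star (V₁ g (Fin.cons s p) i) * (A s s' * piKron Y p q) * V₂ g (Fin.cons s' q) j :=
    fun g => Finset.sum_comm
  simp only [h]
  rw [Finset.sum_comm]
  refine Finset.sum_congr rfl fun s' _ => Finset.sum_congr rfl fun g _ =>
    Finset.sum_congr rfl fun p _ => Finset.sum_congr rfl fun q _ => ?_
  ring

end Sandwich

/-! ### Dimension bound for codes, by induction on the number of factors. -/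

section Bound

variable {d : ℕ}

/-- Three bases `b₀, b₁` of `ℂ²` whose off-diagonal operators `|b₀⟩⟨b₁|` span the traceless
operators. -/
noncomputable def basisVec : Fin 3 → Fin 2 → Fin 2 → ℂ :=
  ![![![1, 0], ![0, 1]], ![![0, 1], ![1, 0]], ![![3 / 5, 4 / 5], ![-4 / 5, 3 / 5]]]

/-- The operators `1 ⊗ |b₀⟩⟨b₁| ⊗ |x⟩⟨y|` on `ℂ² ⊗ ℂ² ⊗ ℂᵈ`. -/
noncomputable def flipOp (l : Fin 3) (x y : Fin d) :
    Matrix (Fin 2 × Fin 2 × Fin d) (Fin 2 × Fin 2 × Fin d) ℂ :=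
  1 ⊗ₖ (ketbra (basisVec l 0) (basisVec l 1) ⊗ₖ single x y 1)

theorem sum_flipOp_smul {M : Type*} [AddCommMonoid M] [Module ℂ M] (l : Fin 3) (x y : Fin d)
    (f : Fin 2 × Fin 2 × Fin d → Fin 2 × Fin 2 × Fin d → M) :
    ∑ s, ∑ s', flipOp l x y s s' • f s s' =
      ∑ e, ∑ c, ∑ c', (basisVec l 0 c * star (basisVec l 1 c')) • f (e, c, x) (e, c', y) := by
  simp only [Fintype.sum_prod_type, flipOp, kroneckerMap_apply, one_apply, ketbra,
    vecMulVec_apply, Pi.star_apply]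
  refine Finset.sum_congr rfl fun e _ => Finset.sum_congr rfl fun c _ => ?_
  rw [Finset.sum_eq_single x, Finset.sum_eq_single e]
  · refine Finset.sum_congr rfl fun c' _ => ?_
    rw [Finset.sum_eq_single y]
    · simp
    · intro z _ hz; simp [single, hz.symm]
    · simp
  · intro z _ hz; simp [hz.symm]
  · simp
  · intro z _ hz; simp [single, hz.symm]
  · simp

/-- If `V₁† (1 ⊗ Y₁ ⊗ ⋯ ⊗ Yₖ) V₂` is scalar whenever every `Yₜ` is `1` or a `flipOp`, and is not
always zero, then the dimension of the code is at most `|γ| dᵏ`. -/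
theorem card_le_of_sandwich {k : ℕ} (hd : 2 ≤ d) {γ μ : Type} [Fintype γ] [Fintype μ]
    [DecidableEq μ]
    (V₁ V₂ : γ → (Fin k → Fin 2 × Fin 2 × Fin d) → μ → ℂ)
    (hs : ∀ Y : Fin k → Matrix (Fin 2 × Fin 2 × Fin d) (Fin 2 × Fin 2 × Fin d) ℂ,
      (∀ t, Y t = 1 ∨ ∃ l x y, Y t = flipOp l x y) →
        ∃ z : ℂ, sandwich V₁ V₂ Y = z • (1 : Matrix μ μ ℂ))
    (hne : ∃ Y : Fin k → Matrix (Fin 2 × Fin 2 × Fin d) (Fin 2 × Fin 2 × Fin d) ℂ,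
      (∀ t, Y t = 1 ∨ ∃ l x y, Y t = flipOp l x y) ∧ sandwich V₁ V₂ Y ≠ 0) :
    Fintype.card μ ≤ Fintype.card γ * d ^ k := by
  induction k generalizing γ μ with
  | zero =>
    obtain ⟨Y, hY, hne⟩ := hne
    obtain ⟨z, hz⟩ := hs Y hY
    have hz0 : z ≠ 0 := by rintro rfl; simp [hz] at hne
    let W₁ : Matrix γ μ ℂ := Matrix.of fun g i => V₁ g default i
    let W₂ : Matrix γ μ ℂ := Matrix.of fun g i => V₂ g default i
    -- With no factors left, the identity on μ factors through γ, and rank gives the bound.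
    have hW : (z⁻¹ • W₁ᴴ) * W₂ = 1 := by
      have h1 : W₁ᴴ * W₂ = sandwich V₁ V₂ Y := by
        ext i j
        simp [sandwich, mul_apply, W₁, W₂, piKron]
      rw [Matrix.smul_mul, h1, hz, smul_smul, inv_mul_cancel₀ hz0, one_smul]
    have h1 := (rank_mul_le_right (z⁻¹ • W₁ᴴ) W₂).trans (rank_le_card_height W₂)
    simpa [hW] using h1
  | succ k ih =>
    by_cases hc : ∃ (l : Fin 3) (x y : Fin d)
        (Y : Fin k → Matrix (Fin 2 × Fin 2 × Fin d) (Fin 2 × Fin 2 × Fin d) ℂ),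
        (∀ t, Y t = 1 ∨ ∃ l x y, Y t = flipOp l x y) ∧
          sandwich V₁ V₂ (Fin.cons (flipOp l x y) Y :
            Fin (k + 1) → Matrix (Fin 2 × Fin 2 × Fin d) (Fin 2 × Fin 2 × Fin d) ℂ) ≠ 0
    -- A nonvanishing flip: contract the first factor with its ket in `V₁` and its bra in `V₂`. Only
    -- the reference qubit joins γ, and its factor 2 is at most `d`.
    · obtain ⟨l, x, y, Y, hY, hne⟩ := hc
      let W₁ : γ × Fin 2 → (Fin k → Fin 2 × Fin 2 × Fin d) → μ → ℂ := fun g p i =>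
        ∑ c, star (basisVec l 0 c) * V₁ g.1 (Fin.cons (g.2, c, x) p) i
      let W₂ : γ × Fin 2 → (Fin k → Fin 2 × Fin 2 × Fin d) → μ → ℂ := fun g p i =>
        ∑ c, star (basisVec l 1 c) * V₂ g.1 (Fin.cons (g.2, c, y) p) i
      have hW : ∀ Z, sandwich W₁ W₂ Z = sandwich V₁ V₂ (Fin.cons (flipOp l x y) Z :
            Fin (k + 1) → Matrix (Fin 2 × Fin 2 × Fin d) (Fin 2 × Fin 2 × Fin d) ℂ) := by
        intro Z
        rw [sandwich_cons, sum_flipOp_smul]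
        ext i j
        simp only [Matrix.sum_apply, Matrix.smul_apply, smul_eq_mul]
        simp only [sandwich, of_apply, Fintype.sum_prod_type, Fin.sum_univ_two, W₁, W₂,
          Finset.mul_sum, ← Finset.sum_add_distrib, star_add, star_mul', star_star]
        refine Finset.sum_congr rfl fun g _ => Finset.sum_congr rfl fun p _ =>
          Finset.sum_congr rfl fun q _ => ?_
        ring
      have h1 := ih W₁ W₂ (fun Z hZ => ?_) ⟨Y, hY, by rwa [hW]⟩
      · rw [Fintype.card_prod, Fintype.card_fin] at h1
        refine h1.trans ?_
        rw [pow_succ, mul_assoc, mul_comm (d ^ k) d]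
        gcongr
      · rw [hW]
        refine hs _ fun t => Fin.cases (Or.inr ⟨l, x, y, rfl⟩) (fun t => ?_) t
        simpa using hZ t
    · push Not at hc
      -- All flips vanish: move the control qubit of the first factor from the rows to the code
      -- index. The new sandwich is half the old one tensored with the identity of ℂ², so the
      -- induction gives 2|μ| ≤ |γ| · 2d · dᵏ.
      let W : (γ → (Fin (k + 1) → Fin 2 × Fin 2 × Fin d) → μ → ℂ) →
          (γ × Fin 2 × Fin d) → (Fin k → Fin 2 × Fin 2 × Fin d) → μ × Fin 2 → ℂ :=
        fun V g p i => V g.1 (Fin.cons (g.2.1, i.2, g.2.2) p) i.1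
      have hblock : ∀ Z i j, sandwich (W V₁) (W V₂) Z i j = ∑ e, ∑ x,
          sandwich (fun g p => V₁ g (Fin.cons (e, i.2, x) p))
            (fun g p => V₂ g (Fin.cons (e, j.2, x) p)) Z i.1 j.1 := by
        intro Z i j
        simp only [sandwich, of_apply, Fintype.sum_prod_type, W]
        rw [Finset.sum_comm]
        refine Finset.sum_congr rfl fun e _ => ?_
        rw [Finset.sum_comm]
      have hW : ∀ Z : Fin k → Matrix (Fin 2 × Fin 2 × Fin d) (Fin 2 × Fin 2 × Fin d) ℂ,
          (∀ t, Z t = 1 ∨ ∃ l x y, Z t = flipOp l x y) → ∀ i j,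
          sandwich (W V₁) (W V₂) Z i j = if i.2 = j.2 then (1 / 2 : ℂ) *
            sandwich V₁ V₂ (Fin.cons 1 Z : Fin (k + 1) →
              Matrix (Fin 2 × Fin 2 × Fin d) (Fin 2 × Fin 2 × Fin d) ℂ) i.1 j.1 else 0 := by
        intro Z hZ i j
        rw [hblock]
        obtain ⟨i, c⟩ := i
        obtain ⟨j, c'⟩ := j
        have h1 : ∀ l x, ∑ e, ∑ c, ∑ c', (basisVec l 0 c * star (basisVec l 1 c')) *
            sandwich (fun g p => V₁ g (Fin.cons (e, c, x) p))
            (fun g p => V₂ g (Fin.cons (e, c', x) p)) Z i j = 0 := by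
          intro l x
          have h2 := hc l x x Z hZ
          rw [sandwich_cons, sum_flipOp_smul] at h2
          have h3 := congrFun (congrFun h2 i) j
          simpa only [Matrix.sum_apply, Matrix.smul_apply, smul_eq_mul, Matrix.zero_apply] using h3
        set S : Fin 2 → Fin 2 → Fin d → Fin 2 → ℂ := fun c c' x e =>
          sandwich (fun g p => V₁ g (Fin.cons (e, c, x) p))
            (fun g p => V₂ g (Fin.cons (e, c', x) p)) Z i j with hS
        have h01 : ∀ x, ∑ e, S 0 1 x e = 0 := fun x => by
          simpa [basisVec, Fin.sum_univ_two] using h1 0 x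
        have h10 : ∀ x, ∑ e, S 1 0 x e = 0 := fun x => by
          simpa [basisVec, Fin.sum_univ_two] using h1 1 x
        have h00 : ∀ x, ∑ e, S 0 0 x e = ∑ e, S 1 1 x e := fun x => by
          have h2 := h1 2 x
          have h3 := h01 x
          have h4 := h10 x
          simp only [Fin.sum_univ_two] at h2 h3 h4 ⊢
          simp only [basisVec, Matrix.cons_val, star_div₀, star_neg, star_ofNat] at h2
          -- For the third basis, |b₀⟩⟨b₁| has rows (-12, 9)/25 and (-16, 12)/25; removing the
          -- off-diagonal terms leaves the difference of the diagonal ones.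
          linear_combination (-25 / 12) * h2 + (9 / 12) * h3 - (16 / 12) * h4
        have hT : sandwich V₁ V₂ (Fin.cons 1 Z : Fin (k + 1) →
              Matrix (Fin 2 × Fin 2 × Fin d) (Fin 2 × Fin 2 × Fin d) ℂ) i j =
            ∑ e, ∑ x, (S 0 0 x e + S 1 1 x e) := by
          rw [sandwich_cons]
          simp only [one_apply, ite_smul, one_smul, zero_smul, Finset.sum_ite_eq,
            Finset.mem_univ, if_true, Matrix.sum_apply, Fintype.sum_prod_type, hS,
            Finset.sum_add_distrib]
          rw [← Finset.sum_add_distrib]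
          refine Finset.sum_congr rfl fun e _ => ?_
          rw [Fin.sum_univ_two]
        have hx : ∀ c c', ∑ e, ∑ x, S c c' x e = ∑ x, ∑ e, S c c' x e :=
          fun _ _ => Finset.sum_comm
        have hT' : ∑ e, ∑ x, S 1 1 x e = ∑ e, ∑ x, S 0 0 x e := by
          rw [hx, hx]; exact Finset.sum_congr rfl fun x _ => (h00 x).symm
        simp only [Finset.sum_add_distrib] at hT
        rw [hT'] at hT
        change ∑ e, ∑ x, S c c' x e = _
        rw [hT]
        fin_cases c <;> fin_cases c'
        · simp; ring
        · simp only [Fin.mk_one, Fin.zero_eta]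
          rw [hx]; simp [h01]
        · simp only [Fin.mk_one, Fin.zero_eta]
          rw [hx]; simp [h10]
        · simp [hT']; ring
      obtain ⟨Y, hY, hne⟩ := hne
      have hY0 : Y 0 = 1 := by
        rcases hY 0 with h | ⟨l, x, y, h⟩
        · exact h
        · refine absurd (hc l x y (Fin.tail Y) fun t => hY t.succ) ?_
          rwa [← h, Fin.cons_self_tail]
      have h1 := ih (W V₁) (W V₂) (fun Z hZ => ?_) ⟨Fin.tail Y, fun t => hY t.succ, ?_⟩
      · rw [Fintype.card_prod, Fintype.card_prod, Fintype.card_prod, Fintype.card_fin,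
          Fintype.card_fin] at h1
        rw [pow_succ]
        nlinarith
      · obtain ⟨z, hz⟩ := hs (Fin.cons 1 Z) (fun t => Fin.cases (Or.inl rfl) (fun t => by
          simpa using hZ t) t)
        refine ⟨1 / 2 * z, ?_⟩
        ext i j
        rw [hW Z hZ, hz]
        by_cases h2 : i.2 = j.2 <;> by_cases h1 : i.1 = j.1 <;>
          simp [one_apply, Prod.ext_iff, h1, h2]
      · intro h0
        apply hne
        ext i j
        have h1 := congrFun (congrFun h0 (i, 0)) (j, 0)
        rw [hW (Fin.tail Y) fun t => hY t.succ] at h1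
        rw [← Fin.cons_self_tail Y, hY0]
        simpa using h1

end Bound

/-! ### From one-shot bounds to capacities. -/

section Capacities

variable {a b ι : Type*} [Fintype a] [DecidableEq a] [Fintype b] [DecidableEq b] [Fintype ι]

theorem krausMap_one : krausMap (fun _ : Unit => (1 : Matrix a a ℂ)) = LinearMap.id := by
  ext1 X
  simp [krausMap_apply]

theorem tensorPow_id (k : ℕ) :
    tensorPow k (LinearMap.id : SuperMap a a) = LinearMap.id := by
  rw [← krausMap_one, tensorPow_krausMap, piKron_one]
  ext1 X
  simp [krausMap_apply]

theorem sendsSubspace_id : SendsSubspace (LinearMap.id : SuperMap a a) (Fintype.card a) := by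
  let e := (Fintype.equivFin a).symm
  let V : Matrix a (Fin (Fintype.card a)) ℂ := (1 : Matrix a a ℂ).submatrix id e
  have hV : Vᴴ * V = 1 := by
    rw [conjTranspose_submatrix, conjTranspose_one, ← submatrix_mul _ _ e id e Function.bijective_id,
      Matrix.one_mul, submatrix_one_equiv]
  have hV' : V * Vᴴ = 1 := by
    rw [conjTranspose_submatrix, conjTranspose_one, ← submatrix_mul _ _ id e id e.bijective,
      Matrix.one_mul, submatrix_id_id]
  refine ⟨V, hV, krausMap fun _ : Unit => Vᴴ, isChannel_krausMap _ (by simpa using hV'), ?_⟩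
  intro ψ
  rw [LinearMap.id_apply, krausMap_apply, Fintype.sum_unique, mul_ketbra_mul, mulVec_mulVec, hV,
    one_mulVec]

theorem alphaQ_id : alphaQ (LinearMap.id : SuperMap a a) = Fintype.card a :=
  le_antisymm (csSup_le' fun _ h => h.le) (le_csSup (bddAbove_sendsSubspace _) sendsSubspace_id)

theorem Q0_idQubit : Q0 idQubit = 1 := by
  have h : ∀ k : ℕ+, Real.logb 2 (alphaQ (tensorPow (k : ℕ) idQubit)) / (k : ℕ) = 1 := by
    intro k
    rw [idQubit, tensorPow_id, alphaQ_id]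
    have hk : ((k : ℕ) : ℝ) ≠ 0 := by exact_mod_cast k.ne_zero
    simp [Real.logb_pow, hk]
  rw [Q0]
  simp only [h, ciSup_const]

theorem tensorPow_one_apply (Φ : SuperMap a b) (X : Matrix (Fin 1 → a) (Fin 1 → a) ℂ) :
    tensorPow 1 Φ X =
      (Φ (X.submatrix (fun s _ => s) fun s _ => s)).submatrix (fun i => i 0) fun i => i 0 := by
  ext i j
  rw [submatrix_apply, apply_eq_sum_single Φ]
  simp only [tensorPow, LinearMap.coe_mk, AddHom.coe_mk, of_apply, Fin.prod_univ_one]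
  refine Fintype.sum_equiv (Equiv.funUnique (Fin 1) a) _ _ fun p => ?_
  refine Fintype.sum_equiv (Equiv.funUnique (Fin 1) a) _ _ fun q => ?_
  have h : ∀ p : Fin 1 → a, (fun _ => p 0) = p := fun p =>
    funext fun t => congrArg p (Subsingleton.elim _ _)
  simp [h]

theorem SendsSubspace.tensorPow_one {Φ : SuperMap a b} {m : ℕ} (h : SendsSubspace Φ m) :
    SendsSubspace (tensorPow 1 Φ) m := by
  obtain ⟨V, hV, R, ⟨n, L, hL, rfl⟩, hR⟩ := h
  let ea := Equiv.funUnique (Fin 1) a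
  let eb := Equiv.funUnique (Fin 1) b
  refine ⟨V.submatrix ea id, ?_, krausMap fun r => (L r).submatrix id eb,
    isChannel_krausMap _ ?_, fun ψ => ?_⟩
  · rw [conjTranspose_submatrix, ← submatrix_mul _ _ id ea id ea.bijective, hV, submatrix_id_id]
  · simp only [conjTranspose_submatrix, ← submatrix_mul _ _ eb id eb Function.bijective_id]
    have h1 : ∑ r, ((L r)ᴴ * L r).submatrix eb eb = (∑ r, (L r)ᴴ * L r).submatrix eb eb := by
      ext i j; simp [Matrix.sum_apply]
    rw [h1, hL, submatrix_one_equiv]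
  · rw [tensorPow_one_apply, ← hR ψ]
    simp only [krausMap_apply]
    refine Finset.sum_congr rfl fun r _ => ?_
    have h1 : (ketbra (V.submatrix ea id *ᵥ ψ) (V.submatrix ea id *ᵥ ψ)).submatrix
        (fun s (_ : Fin 1) => s) (fun s _ => s) = ketbra (V *ᵥ ψ) (V *ᵥ ψ) := rfl
    rw [h1]
    have h2 : (fun i : Fin 1 → b => i 0) = eb := rfl
    rw [h2, conjTranspose_submatrix, ← submatrix_mul _ _ id eb eb eb.bijective,
      ← submatrix_mul _ _ id eb id eb.bijective, submatrix_id_id]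

theorem C0_eq_zero {Φ : SuperMap a b}
    (h : ∀ k N, SendsMessages (tensorPow k Φ) N → N ≤ 1) : C0 Φ = 0 := by
  have h1 : ∀ k : ℕ+, Real.logb 2 (alpha (tensorPow (k : ℕ) Φ)) / (k : ℕ) = 0 := fun k => by
    rw [logb_natCast_eq_zero (alpha_le_one (h k)), zero_div]
  rw [C0]
  simp only [h1, ciSup_const]

theorem Q0_eq_zero {Φ : SuperMap a b}
    (h : ∀ k N, SendsMessages (tensorPow k Φ) N → N ≤ 1) : Q0 Φ = 0 := by
  have h1 : ∀ k : ℕ+, Real.logb 2 (alphaQ (tensorPow (k : ℕ) Φ)) / (k : ℕ) = 0 := fun k => by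
    rw [logb_natCast_eq_zero (alphaQ_le_one (h k)), zero_div]
  rw [Q0]
  simp only [h1, ciSup_const]

/-- The term k = 1 already attains the value that bounds every term. -/
theorem Q0_eq_logb {Φ : SuperMap a b} {d : ℕ} (hd : 1 ≤ d) (h1 : SendsSubspace Φ d)
    (h2 : ∀ k m, SendsSubspace (tensorPow k Φ) m → m ≤ d ^ k) : Q0 Φ = Real.logb 2 d := by
  refine le_antisymm (ciSup_le fun k => ?_) ?_
  · have hk : (0 : ℝ) < (k : ℕ) := by exact_mod_cast k.pos
    have h3 : alphaQ (tensorPow (k : ℕ) Φ) ≤ d ^ (k : ℕ) := csSup_le' fun m hm => h2 k m hm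
    rw [div_le_iff₀ hk]
    rcases Nat.eq_zero_or_pos (alphaQ (tensorPow (k : ℕ) Φ)) with h0 | h0
    · rw [h0]
      have : 0 ≤ Real.logb 2 d := Real.logb_nonneg (by norm_num) (by exact_mod_cast hd)
      simpa using mul_nonneg this hk.le
    · calc Real.logb 2 (alphaQ (tensorPow (k : ℕ) Φ)) ≤ Real.logb 2 ((d : ℝ) ^ (k : ℕ)) :=
            Real.logb_le_logb_of_le (by norm_num) (by exact_mod_cast h0) (by exact_mod_cast h3)
        _ = _ := by rw [Real.logb_pow]; ring
  · refine le_trans ?_ (le_ciSup (bddAbove_Q0 Φ) 1)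
    have h3 : d ≤ alphaQ (tensorPow 1 Φ) :=
      le_csSup (bddAbove_sendsSubspace _) h1.tensorPow_one
    simp only [PNat.one_coe, Nat.cast_one, div_one]
    exact Real.logb_le_logb_of_le (by norm_num) (by exact_mod_cast hd) (by exact_mod_cast h3)

end Capacities

/-! ### Upper bound for the qubit-assisted channel. -/

section UpperBound

variable {b ι : Type*} [Fintype b] [DecidableEq b] [Fintype ι] {d : ℕ}

/-- `card_le_of_sandwich` with γ a point and both matrices equal to the code isometry; the identity
operator gives V†V = 1, which is nonzero when m > 0. -/
theorem card_le_of_sendsSubspace_tensorPow (hd : 2 ≤ d)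
    (K : ι → Matrix b (Fin 2 × Fin 2 × Fin d) ℂ)
    (h1 : 1 ∈ Submodule.span ℂ (Set.range fun i : ι × ι => (K i.1)ᴴ * K i.2))
    (hflip : ∀ l x y, flipOp l x y ∈
      Submodule.span ℂ (Set.range fun i : ι × ι => (K i.1)ᴴ * K i.2))
    (k m : ℕ) (h : SendsSubspace (tensorPow k (krausMap K)) m) : m ≤ d ^ k := by
  rcases Nat.eq_zero_or_pos m with rfl | hm
  · exact Nat.zero_le _
  rw [tensorPow_krausMap] at h
  obtain ⟨V, hV, hz⟩ := h.exists_isometry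
  let W : Unit → (Fin k → Fin 2 × Fin 2 × Fin d) → Fin m → ℂ := fun _ p i => V p i
  have hW : ∀ Y, sandwich W W Y = Vᴴ * piKron Y * V := by
    intro Y
    ext i j
    simp only [sandwich, W, of_apply, mul_apply, conjTranspose_apply, Finset.univ_unique,
      Finset.sum_singleton, Finset.sum_mul]
    exact Finset.sum_comm
  let Q : Submodule ℂ (Matrix (Fin k → Fin 2 × Fin 2 × Fin d) (Fin k → Fin 2 × Fin 2 × Fin d) ℂ) :=
    { carrier := {X | ∃ z : ℂ, Vᴴ * X * V = z • (1 : Matrix (Fin m) (Fin m) ℂ)}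
      add_mem' := by
        rintro X X' ⟨z, hz⟩ ⟨z', hz'⟩
        exact ⟨z + z', by rw [Matrix.mul_add, Matrix.add_mul, hz, hz', add_smul]⟩
      zero_mem' := ⟨0, by simp⟩
      smul_mem' := by
        rintro c X ⟨z, hz⟩
        exact ⟨c * z, by rw [Matrix.mul_smul, Matrix.smul_mul, hz, smul_smul]⟩ }
  have hQ : ∀ Y : Fin k → Matrix (Fin 2 × Fin 2 × Fin d) (Fin 2 × Fin 2 × Fin d) ℂ,
      (∀ t, Y t = 1 ∨ ∃ l x y, Y t = flipOp l x y) → piKron Y ∈ Q := by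
    intro Y hY
    refine (piKronMultilinear k _ _).mem_of_mem_span
      (Set.range fun i : ι × ι => (K i.1)ᴴ * K i.2) Q (fun Z hZ => ?_) Y fun t => ?_
    · choose i hi using hZ
      obtain ⟨z, hz⟩ := hz (fun t => (i t).1) (fun t => (i t).2)
      rw [piKron_conjTranspose, piKron_mul] at hz
      have h2 : Z = fun t => (K (i t).1)ᴴ * K (i t).2 := funext fun t => (hi t).symm
      rw [h2]
      exact ⟨z, hz⟩
    · rcases hY t with h | ⟨l, x, y, h⟩
      · rwa [h]
      · rw [h]; exact hflip l x y
  have h3 := card_le_of_sandwich hd W W (fun Y hY => by rw [hW]; exact hQ Y hY)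
    ⟨fun _ => 1, fun _ => Or.inl rfl, by
      rw [hW, piKron_one, Matrix.mul_one, hV]
      intro h0
      have := congrFun (congrFun h0 ⟨0, hm⟩) ⟨0, hm⟩
      simp at this⟩
  simpa using h3

end UpperBound

/-! ### The channel and its entanglement-assisted recovery. -/

section Retro

variable {N d : ℕ} {ψ : Fin N → Fin 2 → Fin 2 → ℂ} {U : Fin N → Matrix.unitaryGroup (Fin d) ℂ}

/-- The unitary applied to the data when the control measurement has outcome `i`. -/
noncomputable def dataUnitary (U : Fin N → Matrix.unitaryGroup (Fin d) ℂ) (p : Fin N × Fin 2) :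
    Matrix (Fin d) (Fin d) ℂ :=
  if p.2 = 0 then 1 else (U p.1 : Matrix (Fin d) (Fin d) ℂ)

theorem dataUnitary_conjTranspose_mul (p : Fin N × Fin 2) :
    (dataUnitary U p)ᴴ * dataUnitary U p = 1 := by
  unfold dataUnitary
  split_ifs
  · simp
  · exact Unitary.coe_star_mul_self (U p.1)

theorem dataUnitary_mul_conjTranspose (p : Fin N × Fin 2) :
    dataUnitary U p * (dataUnitary U p)ᴴ = 1 := by
  unfold dataUnitary
  split_ifs
  · simp
  · exact Unitary.coe_mul_star_self (U p.1)

theorem retroKraus_conjTranspose_mul (k : Fin N) (i j : Fin 2) :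
    (retroKraus ψ U (k, i))ᴴ * retroKraus ψ U (k, j) =
      (1 / N : ℂ) • (ketbra (star (ψ k i)) (star (ψ k j)) ⊗ₖ
        ((dataUnitary U (k, i))ᴴ * dataUnitary U (k, j))) := by
  have hs : star ((1 / Real.sqrt N : ℝ) : ℂ) * ((1 / Real.sqrt N : ℝ) : ℂ) = 1 / N := by
    rw [Complex.star_def, Complex.conj_ofReal, ← Complex.ofReal_mul]
    rw [div_mul_div_comm, Real.mul_self_sqrt (Nat.cast_nonneg N)]
    simp
  simp only [retroKraus]
  rw [conjTranspose_smul, Matrix.smul_mul, Matrix.mul_smul, smul_smul, hs,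
    conjTranspose_kronecker, ← mul_kronecker_mul]
  congr 2
  simp only [ketbra]
  rw [conjTranspose_vecMulVec, vecMulVec_mul_vecMulVec]
  simp

/-- A square matrix with orthonormal columns has orthonormal rows. -/
theorem sum_ketbra_eq_one {v : Fin 2 → Fin 2 → ℂ}
    (hv : ∀ i j, star (v i) ⬝ᵥ v j = if i = j then 1 else 0) (x y : Fin 2) :
    ∑ i, v i x * star (v i y) = if x = y then 1 else 0 := by
  let A : Matrix (Fin 2) (Fin 2) ℂ := Matrix.of fun x i => v i x
  have h : Aᴴ * A = 1 := by
    ext i j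
    rw [one_apply, ← hv i j]
    rfl
  have h' := congrArg (fun B : Matrix (Fin 2) (Fin 2) ℂ => B x y) (mul_eq_one_comm.mp h)
  beta_reduce at h'
  rw [one_apply] at h'
  rw [← h']
  rfl

theorem retroKraus_complete (hN : 0 < N)
    (hψ : ∀ k i j, star (ψ k i) ⬝ᵥ ψ k j = if i = j then 1 else 0) :
    ∑ p, (retroKraus ψ U p)ᴴ * retroKraus ψ U p = 1 := by
  have hN' : (N : ℂ) ≠ 0 := by exact_mod_cast hN.ne'
  have h : ∀ k, ∑ i, ketbra (star (ψ k i)) (star (ψ k i)) = 1 := by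
    intro k
    ext x y
    have := sum_ketbra_eq_one (hψ k) y x
    simp only [Matrix.sum_apply, ketbra, vecMulVec_apply, Pi.star_apply, star_star, one_apply]
    simp only [mul_comm (star _), this, eq_comm]
  simp only [Fintype.sum_prod_type, retroKraus_conjTranspose_mul, dataUnitary_conjTranspose_mul,
    ← Finset.smul_sum]
  have h2 : ∀ k, ∑ i, ketbra (star (ψ k i)) (star (ψ k i)) ⊗ₖ (1 : Matrix (Fin d) (Fin d) ℂ) =
      1 := by
    intro k
    rw [Fin.sum_univ_two, ← add_kronecker, ← Fin.sum_univ_two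
      (fun i => ketbra (star (ψ k i)) (star (ψ k i))), h, one_kronecker_one]
  simp only [h2, Finset.sum_const, Finset.card_univ, Fintype.card_fin]
  rw [← Nat.cast_smul_eq_nsmul ℂ, smul_smul, one_div, inv_mul_cancel₀ hN', one_smul]

/-- The isometry `|ψ⟩ ↦ (|00⟩ + |11⟩)/√2 ⊗ |ψ⟩`. -/
noncomputable def ebitIsometry (d : ℕ) : Matrix (Fin 2 × Fin 2 × Fin d) (Fin d) ℂ :=
  Matrix.of fun p y => if p.1 = p.2.1 ∧ p.2.2 = y then ((1 / Real.sqrt 2 : ℝ) : ℂ) else 0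

theorem ebitIsometry_mulVec (φ : Fin d → ℂ) : ebitIsometry d *ᵥ φ = ebitTensor φ := by
  ext p
  simp only [mulVec, dotProduct, ebitIsometry, of_apply, ebitTensor, ite_and]
  split_ifs <;> simp

theorem inv_sqrt_two_mul_self :
    ((1 / Real.sqrt 2 : ℝ) : ℂ) * ((1 / Real.sqrt 2 : ℝ) : ℂ) = 1 / 2 := by
  rw [← Complex.ofReal_mul, div_mul_div_comm, Real.mul_self_sqrt (by norm_num)]
  norm_num

theorem ebitIsometry_isometry : (ebitIsometry d)ᴴ * ebitIsometry d = 1 := by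
  ext x y
  simp only [mul_apply, conjTranspose_apply, ebitIsometry, of_apply, Fintype.sum_prod_type,
    Fin.sum_univ_two, one_apply]
  have := inv_sqrt_two_mul_self
  by_cases h : x = y
  · subst h
    rw [one_div, Complex.ofReal_inv] at this
    simp
    linear_combination 2 * this
  · simp [h, Ne.symm h]

/-- The Kraus operators of the recovery: read `k`, measure the reference qubit in the basis
`ψ_{k0}, ψ_{k1}` and undo the unitary. -/
noncomputable def recoveryKraus (ψ : Fin N → Fin 2 → Fin 2 → ℂ)
    (U : Fin N → Matrix.unitaryGroup (Fin d) ℂ) (p : Fin N × Fin 2) :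
    Matrix (Fin d) (Fin 2 × Fin N × Fin d) ℂ :=
  Matrix.of fun x q => if p.1 = q.2.1 then
    star (ψ p.1 p.2 q.1) * (dataUnitary U p)ᴴ x q.2.2 else 0

theorem recoveryKraus_complete
    (hψ : ∀ k i j, star (ψ k i) ⬝ᵥ ψ k j = if i = j then 1 else 0) :
    ∑ p, (recoveryKraus ψ U p)ᴴ * recoveryKraus ψ U p = 1 := by
  ext ⟨e, k, y⟩ ⟨e', k', y'⟩
  have h : ∀ p : Fin N × Fin 2, ((recoveryKraus ψ U p)ᴴ * recoveryKraus ψ U p)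
      (e, k, y) (e', k', y') = if p.1 = k then (if k = k' then
        (ψ k p.2 e * star (ψ k p.2 e')) * (if y = y' then 1 else 0) else 0) else 0 := by
    rintro ⟨l, i⟩
    have h1 := congrFun (congrFun (dataUnitary_mul_conjTranspose (U := U) (l, i)) y) y'
    rw [one_apply, mul_apply] at h1
    by_cases h2 : l = k
    · subst h2
      by_cases h3 : l = k'
      · subst h3
        simp only [mul_apply, conjTranspose_apply, recoveryKraus, of_apply, if_true] at h1 ⊢
        rw [← h1, Finset.mul_sum]
        refine Finset.sum_congr rfl fun x _ => ?_
        simp only [star_mul', star_star]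
        ring
      · simp [mul_apply, recoveryKraus, h3]
    · simp [mul_apply, recoveryKraus, h2]
  rw [Matrix.sum_apply]
  simp only [h, Fintype.sum_prod_type]
  rw [Finset.sum_comm]
  simp only [Finset.sum_ite_eq', Finset.mem_univ, if_true]
  by_cases h3 : k = k'
  · subst h3
    simp only [if_true, ← Finset.sum_mul, sum_ketbra_eq_one (hψ k), one_apply, Prod.mk.injEq]
    by_cases h4 : e = e' <;> by_cases h5 : y = y' <;> simp [h4, h5]
  · simp [h3]

/-- Projecting one half of the ebit on ψ* leaves ψ, unconjugated, on the other half; this is why the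
channel measures in the conjugate basis. -/
theorem kraus_mul_ebitIsometry (q : Fin N × Fin 2) :
    ((1 : Matrix (Fin 2) (Fin 2) ℂ) ⊗ₖ retroKraus ψ U q) * ebitIsometry d =
      Matrix.of fun p x => if q.1 = p.2.1 then
        (((1 / Real.sqrt N : ℝ) : ℂ) * ((1 / Real.sqrt 2 : ℝ) : ℂ)) *
          (ψ q.1 q.2 p.1 * dataUnitary U q p.2.2 x) else 0 := by
  ext ⟨e, k, y⟩ x
  simp only [mul_apply, kroneckerMap_apply, ebitIsometry, of_apply, Fintype.sum_prod_type,
    retroKraus, Matrix.smul_apply, ketbra, vecMulVec_apply, star_star, ite_and,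
    one_apply, ite_mul, one_mul, zero_mul, mul_ite, mul_zero, smul_eq_mul]
  rw [Finset.sum_eq_single e, Finset.sum_eq_single e, Finset.sum_eq_single x]
  · simp only [if_true, dataUnitary]
    by_cases hk : q.1 = k
    · subst hk
      rw [Pi.single_eq_same, if_pos rfl]
      ring
    · rw [Pi.single_eq_of_ne (Ne.symm hk), if_neg hk]
      ring
  · intro z _ hz; simp [hz]
  · simp
  · intro c _ hc; simp [hc.symm]
  · simp
  · intro c _ hc; simp [hc.symm]
  · simp

/-- The label k is read off, and orthonormality of the basis on the reference qubit singles out the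
outcome. So only `p = q` survives, where the unitary cancels. -/
theorem recoveryKraus_mul
    (hψ : ∀ k i j, star (ψ k i) ⬝ᵥ ψ k j = if i = j then 1 else 0) (p q : Fin N × Fin 2) :
    recoveryKraus ψ U p * (((1 : Matrix (Fin 2) (Fin 2) ℂ) ⊗ₖ retroKraus ψ U q) *
      ebitIsometry d) = if p = q then
        (((1 / Real.sqrt N : ℝ) : ℂ) * ((1 / Real.sqrt 2 : ℝ) : ℂ)) •
          (1 : Matrix (Fin d) (Fin d) ℂ) else 0 := by
  rw [kraus_mul_ebitIsometry]
  obtain ⟨k, i⟩ := p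
  obtain ⟨k', j⟩ := q
  set z := ((1 / Real.sqrt N : ℝ) : ℂ) * ((1 / Real.sqrt 2 : ℝ) : ℂ)
  by_cases hk : k = k'
  · subst hk
    have h : ∀ x x', (recoveryKraus ψ U (k, i) * Matrix.of fun (p : Fin 2 × Fin N × Fin d) x =>
        if k = p.2.1 then z * (ψ k j p.1 * dataUnitary U (k, j) p.2.2 x) else 0) x x' =
        z * ((star (ψ k i) ⬝ᵥ ψ k j) *
          ((dataUnitary U (k, i))ᴴ * dataUnitary U (k, j)) x x') := by
      intro x x'
      rw [mul_apply (M := (dataUnitary U (k, i))ᴴ), dotProduct, Finset.sum_mul_sum,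
        Finset.mul_sum]
      simp only [mul_apply, recoveryKraus, of_apply, Fintype.sum_prod_type, Finset.mul_sum]
      refine Finset.sum_congr rfl fun e _ => ?_
      rw [Finset.sum_eq_single k]
      · refine Finset.sum_congr rfl fun y _ => ?_
        simp only [if_true, Pi.star_apply]
        ring
      · intro l _ hl
        simp [hl.symm]
      · simp
    ext x x'
    refine (h x x').trans ?_
    rw [hψ]
    by_cases hij : i = j
    · subst hij
      simp [dataUnitary_conjTranspose_mul]
    · simp [hij]
  · rw [if_neg (by simp [hk])]
    ext x x'
    simp only [mul_apply, recoveryKraus, of_apply, Matrix.zero_apply]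
    refine Finset.sum_eq_zero fun r _ => ?_
    by_cases h1 : k = r.2.1
    · rw [if_neg (c := k' = r.2.1) (fun h => hk (h1.trans h.symm)), mul_zero]
    · rw [if_neg h1, zero_mul]

theorem recovery_apply (hN : 0 < N)
    (hψ : ∀ k i j, star (ψ k i) ⬝ᵥ ψ k j = if i = j then 1 else 0) (φ : Fin d → ℂ) :
    krausMap (recoveryKraus ψ U) (tensor idQubit (retroChannel ψ U)
      (ketbra (ebitIsometry d *ᵥ φ) (ebitIsometry d *ᵥ φ))) = ketbra φ φ := by
  have hN' : (N : ℂ) ≠ 0 := by exact_mod_cast hN.ne'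
  rw [retroChannel, tensor_id_krausMap]
  simp only [krausMap_apply, Matrix.mul_sum, Matrix.sum_mul, mul_ketbra_mul, mulVec_mulVec,
    recoveryKraus_mul hψ]
  have hz : (((1 / Real.sqrt N : ℝ) : ℂ) * ((1 / Real.sqrt 2 : ℝ) : ℂ)) *
      star (((1 / Real.sqrt N : ℝ) : ℂ) * ((1 / Real.sqrt 2 : ℝ) : ℂ)) = 1 / (2 * N) := by
    rw [star_mul', Complex.star_def, Complex.conj_ofReal, Complex.conj_ofReal,
      mul_mul_mul_comm, inv_sqrt_two_mul_self, ← Complex.ofReal_mul, div_mul_div_comm,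
      Real.mul_self_sqrt (Nat.cast_nonneg N)]
    push_cast
    field_simp
  have h : ∀ p q : Fin N × Fin 2,
      ketbra ((if p = q then (((1 / Real.sqrt N : ℝ) : ℂ) * ((1 / Real.sqrt 2 : ℝ) : ℂ)) •
          (1 : Matrix (Fin d) (Fin d) ℂ) else 0) *ᵥ φ)
        ((if p = q then (((1 / Real.sqrt N : ℝ) : ℂ) * ((1 / Real.sqrt 2 : ℝ) : ℂ)) •
          (1 : Matrix (Fin d) (Fin d) ℂ) else 0) *ᵥ φ) =
      if p = q then (1 / (2 * N) : ℂ) • ketbra φ φ else 0 := by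
    intro p q
    split_ifs
    · rw [smul_mulVec, one_mulVec, ketbra_smul, hz]
    · ext; simp [ketbra, vecMulVec_apply]
  -- The 2N surviving terms have equal weight 1/(2N).
  simp only [h, Finset.sum_ite_eq, Finset.mem_univ, if_true, Finset.sum_const, Finset.card_univ,
    Fintype.card_prod, Fintype.card_fin]
  ext x y
  simp
  field_simp

theorem sendsSubspace_tensor_retroChannel (hN : 0 < N)
    (hψ : ∀ k i j, star (ψ k i) ⬝ᵥ ψ k j = if i = j then 1 else 0) :
    SendsSubspace (tensor idQubit (retroChannel ψ U)) d :=
  ⟨ebitIsometry d, ebitIsometry_isometry, krausMap (recoveryKraus ψ U),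
    isChannel_krausMap _ (recoveryKraus_complete hψ), recovery_apply hN hψ⟩

theorem sendsWithEbit_retroChannel (hN : 0 < N)
    (hψ : ∀ k i j, star (ψ k i) ⬝ᵥ ψ k j = if i = j then 1 else 0) :
    SendsWithEbit (retroChannel ψ U) d := by
  refine ⟨LinearMap.id, isChannel_id, krausMap (recoveryKraus ψ U),
    isChannel_krausMap _ (recoveryKraus_complete hψ), fun φ => ?_⟩
  rw [← ebitIsometry_mulVec, LinearMap.comp_id, recovery_apply hN hψ]

end Retro

/-! ### Choice of the bases and unitaries. -/

section Construction

-- The unitaries of a C⋆-algebra span it; by finite dimension, finitely many of them suffice.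
open scoped Matrix.Norms.L2Operator in
theorem exists_unitary_span_eq_top (d : ℕ) :
    ∃ (n : ℕ) (U : Fin n → Matrix.unitaryGroup (Fin d) ℂ),
      Submodule.span ℂ (Set.range fun i => (U i : Matrix (Fin d) (Fin d) ℂ)) = ⊤ := by
  obtain ⟨f, hf, hspan, -⟩ := Submodule.exists_fun_fin_finrank_span_eq ℂ
    (unitary (Matrix (Fin d) (Fin d) ℂ) : Set (Matrix (Fin d) (Fin d) ℂ))
  refine ⟨_, fun i => ⟨f i, hf i⟩, ?_⟩
  exact hspan.trans (CStarAlgebra.span_unitary _)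

theorem star_basisVec (l : Fin 3) (i : Fin 2) : star (basisVec l i) = basisVec l i := by
  ext j
  fin_cases l <;> fin_cases i <;> fin_cases j <;> simp [basisVec]

theorem basisVec_orthonormal (l : Fin 3) (i j : Fin 2) :
    star (basisVec l i) ⬝ᵥ basisVec l j = if i = j then 1 else 0 := by
  rw [star_basisVec]
  fin_cases l <;> fin_cases i <;> fin_cases j <;> simp [basisVec, dotProduct] <;> norm_num

/-- Any two nonzero vectors are detected by the first and the second vector of one of the three
bases. -/
theorem exists_basisVec_dotProduct_ne_zero (w w' : Fin 2 → ℂ) (hw : w ≠ 0) (hw' : w' ≠ 0) :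
    ∃ l, star (basisVec l 0) ⬝ᵥ w ≠ 0 ∧ star (basisVec l 1) ⬝ᵥ w' ≠ 0 := by
  -- A nonzero vector of ℂ² is orthogonal to at most one of three pairwise independent vectors. So
  -- `w` and `w'` each exclude at most one basis and one of the three remains; the cases below check
  -- this by coordinates.
  by_contra! h
  simp only [star_basisVec] at h
  have h0 := h 0
  have h1 := h 1
  have h2 := h 2
  simp [basisVec, dotProduct, Fin.sum_univ_two] at h0 h1 h2
  have hw1 : ¬ (w 0 = 0 ∧ w 1 = 0) := fun h => hw (by ext i; fin_cases i <;> simp [h.1, h.2])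
  have hw1' : ¬ (w' 0 = 0 ∧ w' 1 = 0) := fun h => hw' (by ext i; fin_cases i <;> simp [h.1, h.2])
  by_cases e0 : w 0 = 0
  · have e1 : w 1 ≠ 0 := fun e => hw1 ⟨e0, e⟩
    have f0 := h1 e1
    have f1 := h2 (by simpa [e0] using e1)
    exact hw1' ⟨f0, by simpa [f0] using f1⟩
  · have f1 := h0 e0
    by_cases e1 : w 1 = 0
    · have f0 := h2 (by simpa [e1] using e0)
      exact hw1' ⟨by simpa [f1] using f0, f1⟩
    · exact hw1' ⟨h1 e1, f1⟩

variable {d n : ℕ}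

/-- The pairs `(b₀ ⊗ x, b₁ ⊗ y)` with `b` one of the three bases. -/
noncomputable def flipPairs (d : ℕ) : Set ((Fin 2 × Fin d → ℂ) × (Fin 2 × Fin d → ℂ)) :=
  Set.range fun p : Fin 3 × Fin d × Fin d =>
    ((fun s => basisVec p.1 0 s.1 * Pi.single (M := fun _ => ℂ) p.2.1 1 s.2),
      fun s => basisVec p.1 1 s.1 * Pi.single (M := fun _ => ℂ) p.2.2 1 s.2)

/-- Choosing the data indices x, y independently, at nonzero entries of `w` and `w'`, reduces the
claim to the qubit. -/
theorem flipPairs_detect (w w' : Fin 2 × Fin d → ℂ) (hw : w ≠ 0) (hw' : w' ≠ 0) :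
    ∃ x ∈ flipPairs d, star x.1 ⬝ᵥ w ≠ 0 ∧ star x.2 ⬝ᵥ w' ≠ 0 := by
  obtain ⟨⟨s, x⟩, hx⟩ := Function.ne_iff.mp hw
  obtain ⟨⟨s', y⟩, hy⟩ := Function.ne_iff.mp hw'
  obtain ⟨l, h1, h2⟩ := exists_basisVec_dotProduct_ne_zero (fun c => w (c, x)) (fun c => w' (c, y))
    (Function.ne_iff.mpr ⟨s, hx⟩) (Function.ne_iff.mpr ⟨s', hy⟩)
  have key : ∀ (v : Fin 2 → ℂ) (z : Fin d) (u : Fin 2 × Fin d → ℂ),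
      star (fun s : Fin 2 × Fin d => v s.1 * Pi.single (M := fun _ => ℂ) z 1 s.2) ⬝ᵥ u =
        star v ⬝ᵥ fun c => u (c, z) := by
    intro v z u
    simp only [dotProduct, Fintype.sum_prod_type, Pi.star_apply, star_mul']
    refine Finset.sum_congr rfl fun c _ => ?_
    rw [Finset.sum_eq_single z]
    · simp
    · intro r _ hr; simp [hr]
    · simp
  exact ⟨_, ⟨(l, x, y), rfl⟩, by rwa [key], by rwa [key]⟩

theorem ketbra_flipPair (l : Fin 3) (x y : Fin d) :
    ketbra (fun s : Fin 2 × Fin d => basisVec l 0 s.1 * Pi.single (M := fun _ => ℂ) x 1 s.2)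
      (fun s => basisVec l 1 s.1 * Pi.single (M := fun _ => ℂ) y 1 s.2) =
      ketbra (basisVec l 0) (basisVec l 1) ⊗ₖ single x y 1 := by
  ext s t
  simp only [ketbra, vecMulVec_apply, kroneckerMap_apply, Pi.star_apply, star_mul', single,
    of_apply, Pi.single_apply]
  by_cases h1 : x = s.2 <;> by_cases h2 : y = t.2 <;> simp [h1, h2, eq_comm]

/-- The bases of the channel with `3n` values of `k`. -/
noncomputable def channelBasis (n : ℕ) (k : Fin (3 * n)) : Fin 2 → Fin 2 → ℂ :=
  basisVec (finProdFinEquiv.symm k).1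

/-- The unitaries of the channel with `3n` values of `k`. -/
noncomputable def channelUnitary (U : Fin n → Matrix.unitaryGroup (Fin d) ℂ) (k : Fin (3 * n)) :
    Matrix.unitaryGroup (Fin d) ℂ :=
  U (finProdFinEquiv.symm k).2

/-- For k = (l, i) the product of the Kraus operators of outcomes 0 and 1 is |b₀⟩⟨b₁| ⊗ Uᵢ up to
1/N; linearity in the second factor does the rest. Conjugation is harmless as the bases are real. -/
theorem flip_mem_span (hn : 0 < n) (U : Fin n → Matrix.unitaryGroup (Fin d) ℂ)
    (hU : Submodule.span ℂ (Set.range fun i => (U i : Matrix (Fin d) (Fin d) ℂ)) = ⊤)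
    (l : Fin 3) (X : Matrix (Fin d) (Fin d) ℂ) :
    ketbra (basisVec l 0) (basisVec l 1) ⊗ₖ X ∈ Submodule.span ℂ (Set.range fun i :
      (Fin (3 * n) × Fin 2) × (Fin (3 * n) × Fin 2) =>
        (retroKraus (channelBasis n) (channelUnitary U) i.1)ᴴ *
          retroKraus (channelBasis n) (channelUnitary U) i.2) := by
  have hX : X ∈ Submodule.span ℂ (Set.range fun i => (U i : Matrix (Fin d) (Fin d) ℂ)) := by
    rw [hU]; trivial
  have hN : ((3 * n : ℕ) : ℂ) ≠ 0 := by exact_mod_cast (by omega : 3 * n ≠ 0)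
  induction hX using Submodule.span_induction with
  | mem X hX =>
    obtain ⟨i, rfl⟩ := hX
    have h := retroKraus_conjTranspose_mul (ψ := channelBasis n) (U := channelUnitary U)
      (finProdFinEquiv (l, i)) 0 1
    have h2 : ketbra (basisVec l 0) (basisVec l 1) ⊗ₖ (U i : Matrix (Fin d) (Fin d) ℂ) =
        ((3 * n : ℕ) : ℂ) •
          ((retroKraus (channelBasis n) (channelUnitary U) (finProdFinEquiv (l, i), 0))ᴴ *
            retroKraus (channelBasis n) (channelUnitary U) (finProdFinEquiv (l, i), 1)) := by
      rw [h, smul_smul, mul_one_div_cancel hN, one_smul]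
      simp [channelBasis, channelUnitary, dataUnitary, star_basisVec]
    rw [h2]
    exact Submodule.smul_mem _ _ (Submodule.subset_span ⟨(_, _), rfl⟩)
  | zero => simp
  | add X Y _ _ hX hY => rw [kronecker_add]; exact Submodule.add_mem _ hX hY
  | smul c X _ hX => rw [kronecker_smul]; exact Submodule.smul_mem _ _ hX

theorem one_kronecker_mem_span {a b ι : Type*} [Fintype a] [DecidableEq a] [Fintype b]
    [DecidableEq b] (K : ι → Matrix b a ℂ) {X : Matrix a a ℂ}
    (hX : X ∈ Submodule.span ℂ (Set.range fun i : ι × ι => (K i.1)ᴴ * K i.2)) :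
    (1 : Matrix (Fin 2) (Fin 2) ℂ) ⊗ₖ X ∈ Submodule.span ℂ (Set.range fun i : ι × ι =>
      ((1 : Matrix (Fin 2) (Fin 2) ℂ) ⊗ₖ K i.1)ᴴ * ((1 : Matrix (Fin 2) (Fin 2) ℂ) ⊗ₖ K i.2)) := by
  induction hX using Submodule.span_induction with
  | mem X hX =>
    obtain ⟨i, rfl⟩ := hX
    refine Submodule.subset_span ⟨i, ?_⟩
    beta_reduce
    rw [conjTranspose_kronecker, ← mul_kronecker_mul, conjTranspose_one, Matrix.one_mul]
  | zero => simp
  | add X Y _ _ hX hY => rw [kronecker_add]; exact Submodule.add_mem _ hX hY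
  | smul c X _ hX => rw [kronecker_smul]; exact Submodule.smul_mem _ _ hX

end Construction

end ZeroError

theorem theorem3 (d : ℕ) (hd : 3 ≤ d) :
    ∃ (N : ℕ) (ψ : Fin N → Fin 2 → Fin 2 → ℂ) (U : Fin N → Matrix.unitaryGroup (Fin d) ℂ),
      (∀ k i j, star (ψ k i) ⬝ᵥ ψ k j = if i = j then 1 else 0) ∧
      IsChannel (retroChannel ψ U) ∧
      C0 (retroChannel ψ U) = 0 ∧
      Q0 (tensor idQubit (retroChannel ψ U)) = Real.logb 2 d ∧
      Q0 idQubit = 1 ∧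
      Q0 (retroChannel ψ U) = 0 ∧
      Real.logb 2 d > Q0 idQubit + Q0 (retroChannel ψ U) ∧
      d ≤ alphaQ (tensor idQubit (retroChannel ψ U)) ∧
      SendsWithEbit (retroChannel ψ U) d := by
  obtain ⟨n, U, hU⟩ := exists_unitary_span_eq_top d
  have hn : 0 < n := by
    rcases Nat.eq_zero_or_pos n with rfl | h
    · rw [Set.range_eq_empty, Submodule.span_empty] at hU
      have h1 : (1 : Matrix (Fin d) (Fin d) ℂ) = 0 := by
        rw [← Submodule.mem_bot ℂ, hU]; trivial
      have h2 := congrArg (fun A : Matrix (Fin d) (Fin d) ℂ => A ⟨0, by omega⟩ ⟨0, by omega⟩) h1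
      simp at h2
    · exact h
  have hN : 0 < 3 * n := by omega
  have hψ : ∀ k i j, star (channelBasis n k i) ⬝ᵥ channelBasis n k j = if i = j then 1 else 0 :=
    fun k => basisVec_orthonormal _
  have hcomplete := retroKraus_complete (U := channelUnitary U) hN hψ
  have hone : ∀ k M, SendsMessages
      (tensorPow k (retroChannel (channelBasis n) (channelUnitary U))) M → M ≤ 1 := by
    refine sendsMessages_tensorPow_le_one _ (flipPairs d) flipPairs_detect ?_
    rintro _ ⟨⟨l, x, y⟩, rfl⟩
    rw [ketbra_flipPair]
    exact flip_mem_span hn U hU l _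
  have hspan1 : (1 : Matrix (Fin 2 × Fin d) (Fin 2 × Fin d) ℂ) ∈ Submodule.span ℂ (Set.range
      fun i : (Fin (3 * n) × Fin 2) × (Fin (3 * n) × Fin 2) =>
        (retroKraus (channelBasis n) (channelUnitary U) i.1).conjTranspose *
          retroKraus (channelBasis n) (channelUnitary U) i.2) := by
    rw [← hcomplete]
    exact Submodule.sum_mem _ fun p _ => Submodule.subset_span ⟨(p, p), rfl⟩
  have hsend := sendsSubspace_tensor_retroChannel (U := channelUnitary U) hN hψ
  have hupper : ∀ k m, SendsSubspace (tensorPow k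
      (tensor idQubit (retroChannel (channelBasis n) (channelUnitary U)))) m → m ≤ d ^ k := by
    rw [retroChannel, tensor_id_krausMap]
    refine card_le_of_sendsSubspace_tensorPow (by omega) _ ?_ fun l x y => ?_
    · rw [← Matrix.one_kronecker_one]
      exact one_kronecker_mem_span _ hspan1
    · exact one_kronecker_mem_span _ (flip_mem_span hn U hU l _)
  refine ⟨3 * n, channelBasis n, channelUnitary U, hψ, isChannel_krausMap _ hcomplete,
    C0_eq_zero hone, Q0_eq_logb (by omega) hsend hupper, Q0_idQubit, Q0_eq_zero hone, ?_,
    le_csSup (bddAbove_sendsSubspace _) hsend, sendsWithEbit_retroChannel hN hψ⟩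
  -- Only this strict inequality needs d ≥ 3; for d = 2 both sides would equal 1.
  rw [Q0_idQubit, Q0_eq_zero hone, add_zero, gt_iff_lt, Real.lt_logb_iff_rpow_lt (by norm_num)
    (by exact_mod_cast (by omega : 0 < d)), Real.rpow_one]
  exact_mod_cast (by omega : 2 < d)
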